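/- Let $q$ be a power of an odd prime and let $\mathrm{GSp}(4,\mathbb F_q)$ be the group of all $g\in \mathrm{GL}(4,\mathbb F_q)$ with ${}^t g J g=\lambda J$ for some $\lambda\in\mathbb F_q^\times$, where $J=\begin{pmatrix} &&&1\\ &&1&\\ &-1&&\\ -1&&&\end{pmatrix}$. Let $N$ be the subgroup of its upper triangular elements all of whose diagonal entries are $1$. Let $\psi_1,\psi_2:\mathbb F_q\to\mathbb C^\times$ be non-trivial additive characters, and let $\psi_N$ be the character of $N$ given by $\psi_N(n)=\psi_1(n_{23})\,\psi_2(n_{12})$. Let $\mathcal G$ be the complex representation of $\mathrm{GSp}(4,\mathbb F_q)$ induced from $\psi_N$, that is, the space of all functions $W:\mathrm{GSp}(4,\mathbb F_q)\to\mathbb C$ with $W(ng)=\psi_N(n)W(g)$ for $n\in N$, on which the group acts by right translation. Let $\chi_{\mathcal G}$ be its character, and write $(\chi,\eta)=|\mathrm{GSp}(4,\mathbb F_q)|^{-1}\sum_{g}\chi(g)\overline{\eta(g)}$. An irreducible complex representation of $\mathrm{GSp}(4,\mathbb F_q)$ is called generic if it embeds into $\mathcal G$. Then: 1. $(\chi_{\mathcal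 G},\chi_{\mathcal G})=q^2(q-1)$. 2. Every irreducible constituent of $\mathcal G$ occurs with multiplicity one: for every generic irreducible representation $\pi$ with character $\chi_\pi$, $(\chi_\pi,\chi_{\mathcal G})=1$ and $\dim\mathrm{Hom}_{\mathrm{GSp}(4,\mathbb F_q)}(\pi,\mathcal G)=1$. 3. There are exactly $q^2(q-1)$ isomorphism classes of generic irreducible representations of $\mathrm{GSp}(4,\mathbb F_q)$. -/

import Mathlib

/-- The matrix `J` of the alternating form, with antidiagonal entries `1, 1, -1, -1`. -/
def formJ (F : Type*) [Field F] : Matrix (Fin 4) (Fin 4) F :=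
  !![0, 0, 0, 1;
     0, 0, 1, 0;
     0, -1, 0, 0;
     -1, 0, 0, 0]

/-- The group `GSp(4, F)` of all `g ∈ GL(4, F)` with `ᵗg J g = c J` for some `c ∈ Fˣ`. -/
def GSp4 (F : Type*) [Field F] : Subgroup (GL (Fin 4) F) where
  carrier := {g | ∃ c : Fˣ, (g : Matrix (Fin 4) (Fin 4) F).transpose * formJ F *
    (g : Matrix (Fin 4) (Fin 4) F) = (c : F) • formJ F}
  one_mem' := ⟨1, by simp⟩
  mul_mem' := by
    rintro a b ⟨c, hc⟩ ⟨d, hd⟩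
    refine ⟨c * d, ?_⟩
    have h : ((a * b : GL (Fin 4) F) : Matrix (Fin 4) (Fin 4) F).transpose * formJ F *
        ((a * b : GL (Fin 4) F) : Matrix (Fin 4) (Fin 4) F) =
        (b : Matrix (Fin 4) (Fin 4) F).transpose *
          ((a : Matrix (Fin 4) (Fin 4) F).transpose * formJ F *
            (a : Matrix (Fin 4) (Fin 4) F)) * (b : Matrix (Fin 4) (Fin 4) F) := by
      simp [Matrix.transpose_mul, Matrix.mul_assoc]
    rw [h, hc, Matrix.mul_smul, Matrix.smul_mul, hd, smul_smul, Units.val_mul]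
  inv_mem' := by
    rintro a ⟨c, hc⟩
    refine ⟨c⁻¹, ?_⟩
    have h1 : (a : Matrix (Fin 4) (Fin 4) F) *
        ((a⁻¹ : GL (Fin 4) F) : Matrix (Fin 4) (Fin 4) F) = 1 := by
      rw [← Units.val_mul, mul_inv_cancel, Units.val_one]
    have h2 : ((a⁻¹ : GL (Fin 4) F) : Matrix (Fin 4) (Fin 4) F).transpose *
        (a : Matrix (Fin 4) (Fin 4) F).transpose = 1 := by
      rw [← Matrix.transpose_mul, h1, Matrix.transpose_one]
    have h3 : formJ F = (((c⁻¹ : Fˣ) : F)) • ((a : Matrix (Fin 4) (Fin 4) F).transpose *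
        formJ F * (a : Matrix (Fin 4) (Fin 4) F)) := by
      rw [hc, smul_smul, ← Units.val_mul, inv_mul_cancel, Units.val_one, one_smul]
    calc _ = ((a⁻¹ : GL (Fin 4) F) : Matrix (Fin 4) (Fin 4) F).transpose *
          ((((c⁻¹ : Fˣ) : F)) • ((a : Matrix (Fin 4) (Fin 4) F).transpose *
            formJ F * (a : Matrix (Fin 4) (Fin 4) F))) *
          ((a⁻¹ : GL (Fin 4) F) : Matrix (Fin 4) (Fin 4) F) := by rw [← h3]
      _ = (((c⁻¹ : Fˣ) : F)) •
          ((((a⁻¹ : GL (Fin 4) F) : Matrix (Fin 4) (Fin 4) F).transpose *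
            (a : Matrix (Fin 4) (Fin 4) F).transpose) * formJ F *
          ((a : Matrix (Fin 4) (Fin 4) F) *
            ((a⁻¹ : GL (Fin 4) F) : Matrix (Fin 4) (Fin 4) F))) := by
        simp only [Matrix.mul_smul, Matrix.smul_mul, Matrix.mul_assoc]
      _ = _ := by rw [h1, h2, Matrix.one_mul, Matrix.mul_one]

/-- The `(i, j)` entry of an element of `GSp(4, F)`. -/
def gspEntry {F : Type*} [Field F] (g : GSp4 F) (i j : Fin 4) : F :=
  ((g : GL (Fin 4) F) : Matrix (Fin 4) (Fin 4) F) i j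

theorem gspEntry_one {F : Type*} [Field F] (i j : Fin 4) :
    gspEntry (1 : GSp4 F) i j = if i = j then 1 else 0 := by
  simp [gspEntry, Matrix.one_apply]

theorem gspEntry_mul {F : Type*} [Field F] (g h : GSp4 F) (i j : Fin 4) :
    gspEntry (g * h) i j = ∑ k, gspEntry g i k * gspEntry h k j := by
  simp [gspEntry, Matrix.mul_apply]

/-- The subgroup `N` of the upper triangular elements of `GSp(4, F)` all of whose diagonal
entries are `1`. -/
def unipotentN (F : Type*) [Field F] : Subgroup (GSp4 F) where
  carrier := {g | (∀ i j, j < i → gspEntry g i j = 0) ∧ ∀ i, gspEntry g i i = 1}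
  one_mem' := ⟨fun i j hij => by rw [gspEntry_one, if_neg hij.ne'],
    fun i => by rw [gspEntry_one, if_pos rfl]⟩
  mul_mem' := by
    rintro a b ⟨ha, ha'⟩ ⟨hb, hb'⟩
    have ht : ∀ i j, j < i → gspEntry (a * b) i j = 0 := by
      intro i j hij
      rw [gspEntry_mul]
      refine Finset.sum_eq_zero fun k _ => ?_
      rcases lt_or_ge k i with h | h
      · rw [ha i k h, zero_mul]
      · rw [hb k j (lt_of_lt_of_le hij h), mul_zero]
    refine ⟨ht, fun i => ?_⟩
    rw [gspEntry_mul, Finset.sum_eq_single i, ha', hb', one_mul]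
    · intro k _ hk
      rcases lt_or_gt_of_ne hk with h | h
      · rw [ha i k h, zero_mul]
      · rw [hb k i h, mul_zero]
    · simp
  inv_mem' := by
    rintro a ⟨ha, ha'⟩
    have ht : ∀ i j, j < i → gspEntry a⁻¹ i j = 0 := by
      intro i j hij
      have hM : Matrix.BlockTriangular ((a : GL (Fin 4) F) : Matrix (Fin 4) (Fin 4) F) id :=
        fun i j hij => ha i j hij
      haveI : Invertible ((a : GL (Fin 4) F) : Matrix (Fin 4) (Fin 4) F) :=
        (a : GL (Fin 4) F).invertible
      have := Matrix.blockTriangular_inv_of_blockTriangular hM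
      have h := this (i := i) (j := j) hij
      rw [← Matrix.coe_units_inv] at h
      exact h
    refine ⟨ht, fun i => ?_⟩
    have h : gspEntry (a * a⁻¹) i i = 1 := by rw [mul_inv_cancel, gspEntry_one, if_pos rfl]
    rw [gspEntry_mul, Finset.sum_eq_single i, ha', one_mul] at h
    · exact h
    · intro k _ hk
      rcases lt_or_gt_of_ne hk with h | h
      · rw [ha i k h, zero_mul]
      · rw [ht k i h, mul_zero]
    · simp

/-- The character `ψ_N` of `N` sending a matrix with `(1, 2)` entry `y` and `(2, 3)` entry `x`
(rows and columns numbered from `1`) to `ψ₁(x) ψ₂(y)`. -/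
def psiN {F : Type*} [Field F] (ψ₁ ψ₂ : AddChar F ℂ) : unipotentN F →* ℂ where
  toFun n := ψ₁ (gspEntry (n : GSp4 F) 1 2) * ψ₂ (gspEntry (n : GSp4 F) 0 1)
  map_one' := by simp [gspEntry_one]
  map_mul' := by
    rintro ⟨a, ha, ha'⟩ ⟨b, hb, hb'⟩
    have h1 : gspEntry (a * b) 1 2 = gspEntry a 1 2 + gspEntry b 1 2 := by
      rw [gspEntry_mul, Fin.sum_univ_four, ha 1 0 (by decide), ha' 1, hb' 2,
        hb 3 2 (by decide)]
      ring
    have h2 : gspEntry (a * b) 0 1 = gspEntry a 0 1 + gspEntry b 0 1 := by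
      rw [gspEntry_mul, Fin.sum_univ_four, ha' 0, hb' 1, hb 2 1 (by decide),
        hb 3 1 (by decide)]
      ring
    simp only [Subgroup.coe_mul, h1, h2, AddChar.map_add_eq_mul]
    ring

/-- `ψ_N` as a one-dimensional representation of `N` on `ℂ`. -/
noncomputable def psiNRep {F : Type*} [Field F] (ψ₁ ψ₂ : AddChar F ℂ) :
    Representation ℂ (unipotentN F) ℂ :=
  (Algebra.lmul ℂ ℂ : ℂ →* Module.End ℂ ℂ).comp (psiN ψ₁ ψ₂)

/-- The space of the Gelfand–Graev representation: all functions `W : GSp(4, F) → ℂ` with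
`W (n g) = ψ_N(n) W(g)` for `n ∈ N`. -/
noncomputable abbrev GelfandGraevSpace {F : Type*} [Field F] (ψ₁ ψ₂ : AddChar F ℂ) :
    Submodule ℂ (GSp4 F → ℂ) :=
  Representation.coindV (unipotentN F).subtype (psiNRep ψ₁ ψ₂)

/-- The Gelfand–Graev representation of `GSp(4, F)`, induced from `ψ_N`; the group acts by right
translation, `(h • W)(g) = W (g h)`. -/
noncomputable def gelfandGraev {F : Type*} [Field F] (ψ₁ ψ₂ : AddChar F ℂ) :
    Representation ℂ (GSp4 F) (GelfandGraevSpace ψ₁ ψ₂) :=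
  Representation.coind (unipotentN F).subtype (psiNRep ψ₁ ψ₂)

/-- The inner product `(χ, η) = |G|⁻¹ ∑ g, χ(g) conj(η(g))` of class functions on a finite
group. -/
noncomputable def charInner {G : Type*} [Group G] [Finite G] (χ η : G → ℂ) : ℂ :=
  letI : Fintype G := Fintype.ofFinite G
  (Nat.card G : ℂ)⁻¹ * ∑ g : G, χ g * starRingEnd ℂ (η g)

/-- A representation of `GSp(4, F)` is generic if it is irreducible and embeds into the
Gelfand–Graev representation. -/
def IsGeneric {F : Type*} [Field F] (ψ₁ ψ₂ : AddChar F ℂ)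
    {V : Type*} [AddCommGroup V] [Module ℂ V] (π : Representation ℂ (GSp4 F) V) : Prop :=
  π.IsIrreducible ∧
    ∃ f : Representation.IntertwiningMap π (gelfandGraev ψ₁ ψ₂), Function.Injective f

/-- The set of isomorphism classes of generic representations of `GSp(4, F)`. -/
def genericClasses {F : Type*} [Field F] (ψ₁ ψ₂ : AddChar F ℂ) :
    Set (Quotient (CategoryTheory.isIsomorphicSetoid (FDRep ℂ (GSp4 F)))) :=
  {c | ∃ V : FDRep ℂ (GSp4 F), IsGeneric ψ₁ ψ₂ V.ρ ∧ Quotient.mk _ V = c}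

/-! By Mackey theory the endomorphisms of the induced representation correspond to the functions
with `φ (n * g * n') = ψ n * φ g * ψ n'` (`endToHecke_bijective`), so everything rests on which
double cosets of `N` support such a function. A coset is excluded as soon as `n * g = g * n'` with
`ψ n ≠ ψ n'`. Among torus elements times Weyl elements, the survivors form one family for each of
the four standard Levi subgroups, parametrized by the centre of the Levi: scalar, Siegel, Klingen
and big-cell elements. Their number is (q-1) + 2(q-1)² + (q-1)³ = q²(q-1) (`eq_zero_of_relevantElt`,
`relevantElt_unique`).

The anti-involution g ↦ E ᵗg E preserves `ψ_N` and fixes all these representatives, hence every such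
function. As it reverses products, the endomorphism algebra is commutative (`end_indChar_commute`).

By Maschke and Schur, commutativity makes any two embeddings of an irreducible representation
proportional (`IsIrreducible.exists_eq_smul_of_commute`). The projections onto the constituents are
then a basis of the endomorphism algebra, so its dimension counts the generic classes
(`ncard_constituentClasses`). `charInner_eq_finrank` turns dimensions into inner products. -/

namespace Representation

open Module

/-! ### Characters over ℂ, Maschke and Schur. -/

section Trace

/-- The trace of the inverse of a complex linear automorphism of finite order is the conjugate of
the trace. -/
theorem trace_eq_conj_trace_of_pow_eq_one {V : Type*} [AddCommGroup V] [Module ℂ V]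
    [FiniteDimensional ℂ V] {S T : Module.End ℂ V} (hST : S * T = 1) {n : ℕ} (hn : 0 < n)
    (hT : T ^ n = 1) :
    LinearMap.trace ℂ V S = starRingEnd ℂ (LinearMap.trace ℂ V T) := by
  classical
  -- `T` is annihilated by the separable polynomial `X ^ n - 1`, so it is diagonalizable. On each
  -- eigenspace its inverse `S` acts by `μ⁻¹`, which is the conjugate of `μ` because `μ` is a root
  -- of unity.
  have hss : T.IsSemisimple := by
    apply Module.End.isSemisimple_of_squarefree_aeval_eq_zero
      (p := (Polynomial.X ^ n - 1 : Polynomial ℂ))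
    · exact (Polynomial.separable_X_pow_sub_C (1 : ℂ) (by exact_mod_cast hn.ne') one_ne_zero
        ).squarefree
    · simp [hT]
  have hint : DirectSum.IsInternal T.eigenspace :=
    (DirectSum.isInternal_submodule_iff_iSupIndep_and_iSup_eq_top _).2
      ⟨T.eigenspaces_iSupIndep, hss.iSup_eigenspace_eq_top⟩
  have hS : ∀ {μ : ℂ} {v : V}, v ∈ T.eigenspace μ → S v = starRingEnd ℂ μ • v := by
    intro μ v hv
    have hTv : T v = μ • v := Module.End.mem_eigenspace_iff.1 hv
    by_cases hv0 : v = 0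
    · simp [hv0]
    have hpow : ∀ k : ℕ, (T ^ k) v = μ ^ k • v := by
      intro k
      induction k with
      | zero => simp
      | succ k ih => rw [pow_succ', Module.End.mul_apply, ih, map_smul, hTv, smul_smul, pow_succ]
    have hμ : μ ^ n = 1 := by
      have h := hpow n
      rw [hT, Module.End.one_apply] at h
      have h' : (μ ^ n - 1) • v = 0 := by rw [sub_smul, one_smul, ← h, sub_self]
      exact sub_eq_zero.1 ((smul_eq_zero.1 h').resolve_right hv0)
    have hnorm : ‖μ‖ = 1 := Complex.norm_eq_one_of_pow_eq_one hμ hn.ne'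
    have hconj : starRingEnd ℂ μ * μ = 1 := by
      rw [mul_comm, Complex.mul_conj, Complex.normSq_eq_norm_sq, hnorm]; simp
    have h1 : v = S (T v) := by rw [← Module.End.mul_apply, hST, Module.End.one_apply]
    rw [hTv, map_smul] at h1
    calc S v = (starRingEnd ℂ μ * μ) • S v := by rw [hconj, one_smul]
      _ = starRingEnd ℂ μ • v := by rw [mul_smul, ← h1]
  have hfin : {μ | T.eigenspace μ ≠ ⊥}.Finite :=
    WellFoundedGT.finite_ne_bot_of_iSupIndep T.eigenspaces_iSupIndep
  have hTm : ∀ μ, Set.MapsTo T (T.eigenspace μ) (T.eigenspace μ) := fun μ v hv => by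
    have hTv : T v = μ • v := Module.End.mem_eigenspace_iff.1 hv
    rw [hTv]
    exact Submodule.smul_mem _ _ hv
  have hSm : ∀ μ, Set.MapsTo S (T.eigenspace μ) (T.eigenspace μ) := fun μ v hv => by
    rw [hS hv]
    exact Submodule.smul_mem _ _ hv
  rw [LinearMap.trace_eq_sum_trace_restrict' hint hfin hTm,
    LinearMap.trace_eq_sum_trace_restrict' hint hfin hSm, map_sum]
  refine Finset.sum_congr rfl fun μ _ => ?_
  have h1 : T.restrict (hTm μ) = μ • LinearMap.id := by
    ext v
    exact Module.End.mem_eigenspace_iff.1 v.2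
  have h2 : S.restrict (hSm μ) = starRingEnd ℂ μ • LinearMap.id := by
    ext v
    exact hS v.2
  rw [h1, h2, map_smul, map_smul, LinearMap.trace_id]
  simp

end Trace

variable {G : Type*} [Group G] [Finite G]
  {V W : Type*} [AddCommGroup V] [Module ℂ V] [FiniteDimensional ℂ V]
  [AddCommGroup W] [Module ℂ W] [FiniteDimensional ℂ W]

theorem character_inv_eq_conj (ρ : Representation ℂ G V) (g : G) :
    ρ.character g⁻¹ = starRingEnd ℂ (ρ.character g) :=
  trace_eq_conj_trace_of_pow_eq_one (by rw [← map_mul, inv_mul_cancel, map_one])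
    (Nat.card_pos (α := G)) (by rw [← map_pow, pow_card_eq_one', map_one])

/-- The inner product of the characters of two representations is the dimension of the space of
intertwining maps between them. -/
theorem charInner_eq_finrank (π : Representation ℂ G V) (ρ : Representation ℂ G W) :
    charInner π.character ρ.character = finrank ℂ (IntertwiningMap π ρ) := by
  let : Fintype G := Fintype.ofFinite G
  let : Invertible (Nat.card G : ℂ) :=
    invertibleOfNonzero (by exact_mod_cast (Nat.card_pos (α := G)).ne')
  rw [← card_inv_mul_sum_char_mul_char_eq_finrank, charInner,
    ← Equiv.sum_comp (Equiv.inv G)]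
  congr 1
  refine Finset.sum_congr rfl fun g _ => ?_
  rw [Equiv.inv_apply, ← character_inv_eq_conj, inv_inv, mul_comm]

omit [FiniteDimensional ℂ V] [FiniteDimensional ℂ W] in
/-- Maschke's theorem: an injective intertwining map has an equivariant left inverse. -/
theorem IntertwiningMap.exists_leftInverse_of_injective {π : Representation ℂ G V}
    {ρ : Representation ℂ G W} (f : IntertwiningMap π ρ) (hf : Function.Injective f) :
    ∃ p : IntertwiningMap ρ π, ∀ v, p (f v) = v := by
  obtain ⟨p, hp⟩ := MonoidAlgebra.exists_leftInverse_of_injective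
    (IntertwiningMap.equivLinearMapAsModule π ρ f) (LinearMap.ker_eq_bot.2 hf)
  refine ⟨(IntertwiningMap.equivLinearMapAsModule ρ π).symm p, fun v => ?_⟩
  exact LinearMap.congr_fun hp v

-- Schur's lemma over an algebraically closed field.
omit [Finite G] in
theorem IsIrreducible.exists_smul_eq {π : Representation ℂ G V} [π.IsIrreducible]
    (f : IntertwiningMap π π) : ∃ c : ℂ, ∀ v, f v = c • v := by
  obtain ⟨c, hc⟩ := (IsIrreducible.algebraMap_intertwiningMap_bijective_of_isAlgClosed
    (k := ℂ) (ρ := π)).2 f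
  exact ⟨c, fun v => by rw [← hc]; rfl⟩

omit [FiniteDimensional ℂ W] in
/-- If the endomorphisms of `ρ` commute, two embeddings of an irreducible representation into `ρ`
are proportional. -/
theorem IsIrreducible.exists_eq_smul_of_commute {π : Representation ℂ G V} [π.IsIrreducible]
    {ρ : Representation ℂ G W} (hρ : ∀ S T : IntertwiningMap ρ ρ, S * T = T * S)
    {f : IntertwiningMap π ρ} (hf : Function.Injective f) (f' : IntertwiningMap π ρ) :
    ∃ c : ℂ, f' = c • f := by
  obtain ⟨p, hp⟩ := f.exists_leftInverse_of_injective hf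
  obtain ⟨c, hc⟩ := IsIrreducible.exists_smul_eq (p.comp f')
  refine ⟨c, DFunLike.ext _ _ fun v => ?_⟩
  -- On `f v`, one order of composition gives `f' v`, the other `f (p (f' v))`, which is `c • f v`
  -- by Schur.
  have h := DFunLike.congr_fun (hρ (f'.comp p) (f.comp p)) (f v)
  simp only [IntertwiningMap.mul_apply, IntertwiningMap.comp_apply, hp] at h
  have hcv : p (f' v) = c • v := hc v
  rw [hcv, map_smul] at h
  exact h

omit [FiniteDimensional ℂ W] in
theorem IsIrreducible.finrank_eq_one_of_commute {π : Representation ℂ G V} [π.IsIrreducible]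
    {ρ : Representation ℂ G W} (hρ : ∀ S T : IntertwiningMap ρ ρ, S * T = T * S)
    {f : IntertwiningMap π ρ} (hf : Function.Injective f) :
    finrank ℂ (IntertwiningMap π ρ) = 1 := by
  have : Nontrivial V := by
    by_contra h
    rw [not_nontrivial_iff_subsingleton] at h
    obtain ⟨a, b, hab⟩ := (inferInstance : Nontrivial (Subrepresentation π))
    exact hab (Subrepresentation.toSubmodule_injective (Subsingleton.elim _ _))
  obtain ⟨v, hv⟩ := exists_ne (0 : V)
  refine finrank_eq_one f (fun h => hv (hf ?_)) fun f' => ?_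
  · rw [h]; simp
  · obtain ⟨c, hc⟩ := IsIrreducible.exists_eq_smul_of_commute hρ hf f'
    exact ⟨c, hc.symm⟩

end Representation

/-! ### Counting constituents when the endomorphism algebra is commutative. -/

namespace Representation

open Module CategoryTheory

variable {G : Type*} [Group G]

theorem nonempty_equiv_of_iso {X Y : FDRep ℂ G} (i : X ≅ Y) : Nonempty (Equiv X.ρ Y.ρ) :=
  ⟨Equiv.mk (FDRep.isoToLinearEquiv i) fun g => by
    rw [FDRep.Iso.conj_ρ i g]
    ext v
    simp⟩

theorem nonempty_iso_of_equiv {X Y : FDRep ℂ G} (e : Equiv X.ρ Y.ρ) : Nonempty (X ≅ Y) :=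
  ⟨Action.mkIso (LinearEquiv.toFGModuleCatIso e.toLinearEquiv) fun g => by
    ext1
    exact e.isIntertwining' g⟩

/-- A basis moves the action to coordinate space, which lies in `Type` whatever the universe of `V`.
-/
theorem exists_FDRep_equiv {V : Type*} [AddCommGroup V] [Module ℂ V] [FiniteDimensional ℂ V]
    (π : Representation ℂ G V) : ∃ X : FDRep ℂ G, Nonempty (Equiv X.ρ π) := by
  let e : (Fin (finrank ℂ V) → ℂ) ≃ₗ[ℂ] V := (finBasis ℂ V).equivFun.symm
  let σ : Representation ℂ G (Fin (finrank ℂ V) → ℂ) :=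
    (e.symm.conjAlgEquiv ℂ : Module.End ℂ V →* _).comp π
  refine ⟨FDRep.of σ, ⟨Equiv.mk e fun g => ?_⟩⟩
  rw [FDRep.of_ρ']
  ext v
  simp [σ]

theorem IsIrreducible.of_equiv {V W : Type*} [AddCommGroup V] [Module ℂ V]
    [AddCommGroup W] [Module ℂ W] {π : Representation ℂ G V} {ρ : Representation ℂ G W}
    (e : Equiv π ρ) (h : ρ.IsIrreducible) : π.IsIrreducible := by
  rw [irreducible_iff_isSimpleModule_asModule] at h ⊢
  let f := IntertwiningMap.equivLinearMapAsModule π ρ e.toIntertwiningMap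
  exact IsSimpleModule.congr (LinearEquiv.ofBijective f e.toLinearEquiv.bijective)

/-- A subrepresentation of `U` pushes forward to a subrepresentation of `ρ` below the atom `U`. -/
theorem isIrreducible_toRepresentation {V : Type*} [AddCommGroup V] [Module ℂ V]
    {ρ : Representation ℂ G V} {U : Subrepresentation ρ} (hU : IsAtom U) :
    IsIrreducible U.toRepresentation := by
  have hne : ∃ u ∈ U.toSubmodule, u ≠ 0 := by
    by_contra! h
    refine hU.1 (le_bot_iff.1 fun u hu => ?_)
    rw [h u hu]
    exact (⊥ : Subrepresentation ρ).toSubmodule.zero_mem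
  obtain ⟨u, huU, hu⟩ := hne
  refine @IsSimpleOrder.mk _ _ _ ⟨⟨⊥, ⊤, fun h => ?_⟩⟩ fun P => ?_
  · have hmem : (⟨u, huU⟩ : U.toSubmodule) ∈ (⊥ : Submodule ℂ U.toSubmodule) := by
      have := congrArg Subrepresentation.toSubmodule h
      change (⊥ : Submodule ℂ U.toSubmodule) = ⊤ at this
      rw [this]
      trivial
    exact hu (congrArg Subtype.val ((Submodule.mem_bot ℂ).1 hmem))
  · let Q : Subrepresentation ρ :=
      { toSubmodule := P.toSubmodule.map U.toSubmodule.subtype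
        apply_mem_toSubmodule := by
          rintro g _ ⟨x, hx, rfl⟩
          exact ⟨U.toRepresentation g x, P.apply_mem_toSubmodule g hx, rfl⟩ }
    have hQU : Q ≤ U := by
      rintro _ ⟨x, hx, rfl⟩
      exact x.2
    rcases hU.le_iff.1 hQU with h | h
    · left
      refine le_bot_iff.1 fun x hx => ?_
      have hmem : (x : V) ∈ Q := ⟨x, hx, rfl⟩
      rw [h] at hmem
      exact (Submodule.mem_bot ℂ).2 (Subtype.ext ((Submodule.mem_bot ℂ).1 hmem))
    · right
      refine top_le_iff.1 fun x _ => ?_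
      obtain ⟨y, hy, hyx⟩ : (x : V) ∈ Q := h.ge x.2
      rwa [← Subtype.ext hyx]

open scoped MonoidAlgebra in
/-- A nonzero intertwining map is nonzero on some irreducible subrepresentation. -/
theorem exists_irreducible_comp_ne_zero [Finite G] {V W : Type*} [AddCommGroup V] [Module ℂ V]
    [FiniteDimensional ℂ V] [AddCommGroup W] [Module ℂ W]
    {ρ : Representation ℂ G V} {σ : Representation ℂ G W} {T : IntertwiningMap ρ σ} (hT : T ≠ 0) :
    ∃ (X : FDRep ℂ G) (f : IntertwiningMap X.ρ ρ), IsIrreducible X.ρ ∧ Function.Injective f ∧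
      ∃ v, T (f v) ≠ 0 := by
  let T' := IntertwiningMap.equivLinearMapAsModule ρ σ T
  -- By semisimplicity the simple submodules span, so they cannot all lie in the kernel.
  obtain ⟨N, hN, hNT⟩ : ∃ N : Submodule ℂ[G] ρ.asModule, IsSimpleModule ℂ[G] N ∧
      ¬ N ≤ LinearMap.ker T' := by
    by_contra! h
    have htop : (⊤ : Submodule ℂ[G] ρ.asModule) ≤ LinearMap.ker T' := by
      rw [← IsSemisimpleModule.sSup_simples_eq_top]
      exact sSup_le h
    exact hT ((LinearEquiv.map_eq_zero_iff (IntertwiningMap.equivLinearMapAsModule ρ σ)).1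
      (LinearMap.ker_eq_top.1 (top_le_iff.1 htop)))
  obtain ⟨w, hwN, hwT⟩ := SetLike.not_le_iff_exists.1 hNT
  let U : Subrepresentation ρ := Subrepresentation.ofSubmodule' N
  have hU : IsAtom U := (OrderIso.isAtom_iff
    Subrepresentation.subrepresentationSubmoduleOrderIso.symm N).2 (isSimpleModule_iff_isAtom.1 hN)
  let i : IntertwiningMap U.toRepresentation ρ := ⟨U.toSubmodule.subtype, fun g => rfl⟩
  obtain ⟨X, ⟨e⟩⟩ := exists_FDRep_equiv U.toRepresentation
  refine ⟨X, i.comp e.toIntertwiningMap, (isIrreducible_toRepresentation hU).of_equiv e,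
    Subtype.val_injective.comp e.toLinearEquiv.injective, e.symm ⟨w, hwN⟩, ?_⟩
  have : e.toIntertwiningMap (e.symm ⟨w, hwN⟩) = ⟨w, hwN⟩ := e.apply_symm_apply _
  rw [IntertwiningMap.comp_apply, this]
  exact hwT

/-- The set of isomorphism classes of irreducible representations embedding into `ρ`. -/
def constituentClasses {V : Type*} [AddCommGroup V] [Module ℂ V] (ρ : Representation ℂ G V) :
    Set (Quotient (isIsomorphicSetoid (FDRep ℂ G))) :=
  {c | ∃ X : FDRep ℂ G, (IsIrreducible X.ρ ∧
    ∃ f : IntertwiningMap X.ρ ρ, Function.Injective f) ∧ Quotient.mk _ X = c}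

/-- If the endomorphisms of `ρ` commute, the number of isomorphism classes of its irreducible
constituents is the dimension of the endomorphism algebra. -/
theorem ncard_constituentClasses [Finite G] {V : Type*} [AddCommGroup V] [Module ℂ V]
    [FiniteDimensional ℂ V] {ρ : Representation ℂ G V}
    (hρ : ∀ S T : IntertwiningMap ρ ρ, S * T = T * S) :
    (constituentClasses ρ).ncard = finrank ℂ (IntertwiningMap ρ ρ) := by
  choose X hX hXc using fun c : constituentClasses ρ => c.2
  choose hirr f hf using hX
  choose p hp using fun c => (f c).exists_leftInverse_of_injective (hf c)
  have hpf : ∀ c d, c ≠ d → ∀ v, p c (f d v) = 0 := by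
    intro c d hcd v
    have := hirr c
    have := hirr d
    -- By Schur a nonzero composite would identify the two classes.
    rcases IsIrreducible.bijective_or_eq_zero ((p c).comp (f d)) with h | h
    · obtain ⟨i⟩ := nonempty_iso_of_equiv (IntertwiningMap.ofBijective _ h)
      refine absurd (Subtype.ext ?_) hcd
      rw [← hXc c, ← hXc d]
      exact (Quotient.sound (s := isIsomorphicSetoid _) ⟨i⟩).symm
    · exact DFunLike.congr_fun h v
  have hne : ∀ c, ∃ v : X c, v ≠ 0 := by
    intro c
    have := (hirr c).toNontrivial
    by_contra! h
    obtain ⟨a, b, hab⟩ := this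
    refine hab (Subrepresentation.toSubmodule_injective (Submodule.ext fun v => ?_))
    rw [h v]
    simp
  -- These are projections onto the constituents, mutually orthogonal by `hpf`; they will be the
  -- basis.
  let e : constituentClasses ρ → IntertwiningMap ρ ρ := fun c => (f c).comp (p c)
  have hli : LinearIndependent ℂ e := by
    rw [linearIndependent_iff']
    intro s a hs c hc
    obtain ⟨v, hv⟩ := hne c
    have h := DFunLike.congr_fun hs (f c v)
    rw [IntertwiningMap.sum_apply, Finset.sum_eq_single c] at h
    · change a c • f c (p c (f c v)) = 0 at h
      rw [hp, ← map_smul] at h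
      have h' : a c • v = 0 := hf c (h.trans (map_zero _).symm)
      exact (smul_eq_zero.1 h').resolve_right hv
    · intro d _ hdc
      change a d • f d (p d (f c v)) = 0
      rw [hpf d c hdc, map_zero, smul_zero]
    · exact fun h => absurd hc h
  have : Finite (constituentClasses ρ) := hli.finite
  have : Fintype (constituentClasses ρ) := Fintype.ofFinite _
  have hspan : ⊤ ≤ Submodule.span ℂ (Set.range e) := by
    intro T _
    have hT : ∀ c, ∃ a : ℂ, T.comp (f c) = a • f c := fun c =>
      have := hirr c
      IsIrreducible.exists_eq_smul_of_commute hρ (hf c) _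
    choose a ha using hT
    -- Otherwise the difference is nonzero on some irreducible `Y`; but the embedding of `Y` is
    -- proportional to the chosen `f c` of its class, on which the difference vanishes.
    have : T - ∑ c, a c • e c = 0 := by
      by_contra h0
      obtain ⟨Y, j, hY, hj, v, hv⟩ := exists_irreducible_comp_ne_zero h0
      let c : constituentClasses ρ := ⟨Quotient.mk _ Y, Y, ⟨hY, j, hj⟩, rfl⟩
      obtain ⟨i⟩ := Quotient.exact (hXc c)
      obtain ⟨φ⟩ := nonempty_equiv_of_iso i
      have := hirr c
      obtain ⟨b, hb⟩ := IsIrreducible.exists_eq_smul_of_commute hρ (hf c)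
        (j.comp φ.toIntertwiningMap)
      obtain ⟨u, rfl⟩ := φ.toLinearEquiv.surjective v
      have hju : j (φ.toLinearEquiv u) = b • f c u := DFunLike.congr_fun hb u
      refine hv ?_
      have hTu : T (f c u) = a c • f c u := DFunLike.congr_fun (ha c) u
      have hsum : (∑ d, a d • e d) (f c u) = a c • f c u := by
        rw [IntertwiningMap.sum_apply, Finset.sum_eq_single c]
        · change a c • f c (p c (f c u)) = _
          rw [hp]
        · intro d _ hdc
          change a d • f d (p d (f c u)) = 0
          rw [hpf d c hdc, map_zero, smul_zero]
        · simp
      rw [hju, map_smul, IntertwiningMap.coe_sub, Pi.sub_apply, hTu, hsum, sub_self, smul_zero]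
    rw [sub_eq_zero.1 this]
    exact Submodule.sum_mem _ fun c _ =>
      Submodule.smul_mem _ _ (Submodule.subset_span ⟨c, rfl⟩)
  rw [finrank_eq_nat_card_basis (Basis.mk hli hspan)]
  exact (Nat.card_coe_set_eq _).symm

end Representation

/-! ### The Hecke algebra of an induced character and Gelfand's trick. -/

namespace Representation

open Module

variable {G : Type*} [Group G] {N : Subgroup G} (ψ : N →* ℂ)

/-- The representation of `G` induced from the character `ψ` of the subgroup `N`. -/
noncomputable abbrev indChar :
    Representation ℂ G (coindV N.subtype ((Algebra.lmul ℂ ℂ : ℂ →* Module.End ℂ ℂ).comp ψ)) :=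
  coind N.subtype ((Algebra.lmul ℂ ℂ : ℂ →* Module.End ℂ ℂ).comp ψ)

/-- The space of functions on `G` that transform on both sides by the character `ψ` of `N`. -/
def heckeSpace : Submodule ℂ (G → ℂ) where
  carrier := {φ | ∀ (n n' : N) (g : G), φ (n * g * n') = ψ n * φ g * ψ n'}
  add_mem' := fun {a b} ha hb n n' g => by
    simp only [Pi.add_apply, ha n n' g, hb n n' g]; ring
  zero_mem' := fun n n' g => by simp
  smul_mem' := fun c a ha n n' g => by
    simp only [Pi.smul_apply, smul_eq_mul, ha n n' g]; ring

variable {ψ}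

theorem heckeSpace_left {φ : G → ℂ} (hφ : φ ∈ heckeSpace ψ) (n : N) (g : G) :
    φ (n * g) = ψ n * φ g := by
  simpa using hφ n 1 g

theorem heckeSpace_right {φ : G → ℂ} (hφ : φ ∈ heckeSpace ψ) (n : N) (g : G) :
    φ (g * n) = φ g * ψ n := by
  simpa using hφ 1 n g

theorem indChar_left (W : coindV N.subtype ((Algebra.lmul ℂ ℂ : ℂ →* Module.End ℂ ℂ).comp ψ))
    (n : N) (g : G) : W.1 (n * g) = ψ n * W.1 g :=
  W.2 n g

variable (ψ)

open scoped Classical in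
/-- The function on `G` extending `ψ` by zero outside `N`. -/
noncomputable def extendByZero :
    coindV N.subtype ((Algebra.lmul ℂ ℂ : ℂ →* Module.End ℂ ℂ).comp ψ) :=
  ⟨fun g => if h : g ∈ N then ψ ⟨g, h⟩ else 0, fun n g => by
    by_cases h : g ∈ N
    · have h' : (n : G) * g ∈ N := N.mul_mem n.2 h
      change (if h : (n : G) * g ∈ N then ψ ⟨_, h⟩ else 0) = ψ n * (if h : g ∈ N then _ else 0)
      rw [dif_pos h, dif_pos h', ← map_mul]
      rfl
    · have h' : (n : G) * g ∉ N := fun h' => h ((N.mul_mem_cancel_left n.2).1 h')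
      change (if h : (n : G) * g ∈ N then ψ ⟨_, h⟩ else 0) = ψ n * (if h : g ∈ N then _ else 0)
      rw [dif_neg h, dif_neg h', mul_zero]⟩

theorem extendByZero_coe (n : N) : (extendByZero ψ).1 n = ψ n := dif_pos n.2

theorem extendByZero_of_notMem {g : G} (hg : g ∉ N) : (extendByZero ψ).1 g = 0 := dif_neg hg

/-- Right translation by `n'` multiplies `extendByZero ψ` by `ψ n'`, and `T` keeps this; the left
transformation law is membership in the induced space. -/
theorem map_extendByZero_mem
    (T : IntertwiningMap (indChar ψ) (indChar ψ)) :
    (T (extendByZero ψ)).1 ∈ heckeSpace ψ := by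
  intro n n' g
  have h : indChar ψ n' (extendByZero ψ) = ψ n' • extendByZero ψ := by
    refine Subtype.ext (funext fun x => ?_)
    change (extendByZero ψ).1 (x * n') = ψ n' * (extendByZero ψ).1 x
    by_cases hx : x ∈ N
    · have h1 := extendByZero_coe ψ (⟨x, hx⟩ * n')
      have h2 := extendByZero_coe ψ ⟨x, hx⟩
      simp only [Subgroup.coe_mul] at h1 h2
      rw [h1, h2, map_mul, mul_comm]
    · rw [extendByZero_of_notMem ψ hx, extendByZero_of_notMem ψ, mul_zero]
      exact fun h => hx ((N.mul_mem_cancel_right n'.2).1 h)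
  have h2 := IntertwiningMap.isIntertwining _ _ T n' (extendByZero ψ)
  rw [h, map_smul] at h2
  have h3 : ψ n' * (T (extendByZero ψ)).1 ((n : G) * g) =
      (T (extendByZero ψ)).1 ((n : G) * g * n') := congrFun (congrArg Subtype.val h2) (n * g)
  rw [← h3, indChar_left, mul_comm]

/-- The value of an endomorphism of the induced representation on the extension of `ψ` by zero. -/
noncomputable def endToHecke :
    IntertwiningMap (indChar ψ) (indChar ψ) →ₗ[ℂ] heckeSpace ψ where
  toFun T := ⟨(T (extendByZero ψ)).1, map_extendByZero_mem ψ T⟩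
  map_add' _ _ := rfl
  map_smul' _ _ := rfl

open scoped Classical in
theorem sum_ite_mem_eq [Fintype G] (N : Subgroup G) (a : ℂ) :
    (∑ x : G, if x ∈ N then a else 0) = Nat.card N * a := by
  rw [← Finset.sum_filter, Finset.sum_const, nsmul_eq_mul, Nat.card_eq_fintype_card,
    Fintype.card_subtype]

/-- An endomorphism of the induced representation is the convolution with its value at the
extension of `ψ` by zero. -/
theorem card_mul_apply [Fintype G] (T : IntertwiningMap (indChar ψ) (indChar ψ))
    (W : coindV N.subtype ((Algebra.lmul ℂ ℂ : ℂ →* Module.End ℂ ℂ).comp ψ)) (g : G) :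
    Nat.card N * (T W).1 g = ∑ x : G, W.1 x * (T (extendByZero ψ)).1 (g * x⁻¹) := by
  classical
  -- The translates of `extendByZero ψ` span the induced space. At `g`, each of the `Nat.card N`
  -- elements `x` of `N g` contributes `W g`.
  have hW : (Nat.card N : ℂ) • W = ∑ x : G, W.1 x • indChar ψ x⁻¹ (extendByZero ψ) := by
    refine Subtype.ext (funext fun g => ?_)
    rw [AddSubmonoidClass.coe_finsetSum, Finset.sum_apply]
    change (Nat.card N : ℂ) * W.1 g = ∑ x : G, W.1 x * (extendByZero ψ).1 (g * x⁻¹)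
    rw [← sum_ite_mem_eq, ← Equiv.sum_comp (Equiv.divLeft g)]
    refine Finset.sum_congr rfl fun x _ => ?_
    rw [Equiv.divLeft_apply, div_eq_mul_inv]
    by_cases h : g * x⁻¹ ∈ N
    · rw [if_pos h]
      have h1 := extendByZero_coe ψ ⟨_, h⟩
      have h2 := indChar_left W ⟨_, h⟩ x
      simp only [inv_mul_cancel_right] at h1 h2
      rw [h1, h2, mul_comm]
    · rw [if_neg h, extendByZero_of_notMem ψ h, mul_zero]
  have h := congrArg T hW
  rw [map_smul, map_sum] at h
  have h' := congrFun (congrArg Subtype.val h) g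
  rw [AddSubmonoidClass.coe_finsetSum, Finset.sum_apply] at h'
  refine h'.trans (Finset.sum_congr rfl fun x _ => ?_)
  rw [map_smul, IntertwiningMap.isIntertwining]
  rfl

/-- Injectivity is the convolution formula `card_mul_apply`; for surjectivity, `φ` comes from
convolution with `φ`, normalized by the order of `N`. -/
theorem endToHecke_bijective [Finite G] : Function.Bijective (endToHecke ψ) := by
  classical
  have : Fintype G := Fintype.ofFinite G
  have hcard : (Nat.card N : ℂ) ≠ 0 := by exact_mod_cast (Nat.card_pos (α := N)).ne'
  refine ⟨fun S T h => DFunLike.ext _ _ fun W => Subtype.ext (funext fun g => ?_), fun φ => ?_⟩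
  · refine mul_left_cancel₀ hcard ?_
    have h' : (S (extendByZero ψ)).1 = (T (extendByZero ψ)).1 :=
      congrArg (fun φ : heckeSpace ψ => φ.1) h
    rw [card_mul_apply, card_mul_apply, h']
  · let T : IntertwiningMap (indChar ψ) (indChar ψ) :=
      { toFun := fun W => ⟨fun g => (Nat.card N : ℂ)⁻¹ * ∑ x : G, W.1 x * φ.1 (g * x⁻¹),
          fun n g => by
            change _ * ∑ x : G, W.1 x * φ.1 ((n : G) * g * x⁻¹) = ψ n * (_ * ∑ x : G, _)
            rw [mul_left_comm, Finset.mul_sum (a := ψ n)]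
            simp only [mul_assoc (n : G), heckeSpace_left φ.2]
            congr 1
            exact Finset.sum_congr rfl fun x _ => by ring⟩
        map_add' := fun W W' => Subtype.ext (funext fun g => by
          change _ * ∑ x : G, (W.1 x + W'.1 x) * _ = _ * (∑ x : G, _) + _ * (∑ x : G, _)
          rw [← mul_add, ← Finset.sum_add_distrib]
          simp only [add_mul])
        map_smul' := fun c W => Subtype.ext (funext fun g => by
          change _ * ∑ x : G, (c * W.1 x) * _ = c * (_ * ∑ x : G, _)
          rw [mul_left_comm, Finset.mul_sum (a := c)]
          simp only [mul_assoc])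
        isIntertwining' := fun h => LinearMap.ext fun W => Subtype.ext (funext fun g => by
          change _ * ∑ x : G, W.1 (x * h) * φ.1 (g * x⁻¹) =
            _ * ∑ x : G, W.1 x * φ.1 (g * h * x⁻¹)
          congr 1
          rw [← Equiv.sum_comp (Equiv.mulRight h) fun x => W.1 x * φ.1 (g * h * x⁻¹)]
          refine Finset.sum_congr rfl fun x _ => ?_
          simp [mul_assoc]) }
    refine ⟨T, Subtype.ext (funext fun g => ?_)⟩
    change (Nat.card N : ℂ)⁻¹ * ∑ x : G, (extendByZero ψ).1 x * φ.1 (g * x⁻¹) = φ.1 g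
    have : ∀ x, (extendByZero ψ).1 x * φ.1 (g * x⁻¹) = if x ∈ N then φ.1 g else 0 := by
      intro x
      by_cases h : x ∈ N
      · rw [if_pos h]
        have h1 := extendByZero_coe ψ ⟨_, h⟩
        have h2 := heckeSpace_right φ.2 ⟨_, h⟩ (g * x⁻¹)
        simp only [inv_mul_cancel_right] at h1 h2
        rw [h1, h2, mul_comm]
      · rw [if_neg h, extendByZero_of_notMem ψ h, zero_mul]
    rw [Finset.sum_congr rfl fun x _ => this x, sum_ite_mem_eq, inv_mul_cancel_left₀ hcard]

theorem finrank_end_indChar [Finite G] :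
    finrank ℂ (IntertwiningMap (indChar ψ) (indChar ψ)) = finrank ℂ (heckeSpace ψ) :=
  (LinearEquiv.ofBijective _ (endToHecke_bijective ψ)).finrank_eq

/-- Gelfand's trick: if an anti-automorphism of `G` fixes all functions that transform on both
sides by `ψ`, then the endomorphisms of the induced representation commute. -/
theorem end_indChar_commute [Finite G] (ι : G ≃ G) (hι : ∀ g h, ι (g * h) = ι h * ι g)
    (hfix : ∀ φ ∈ heckeSpace ψ, ∀ g, φ (ι g) = φ g)
    (S T : IntertwiningMap (indChar ψ) (indChar ψ)) : S * T = T * S := by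
  have : Fintype G := Fintype.ofFinite G
  have hcard : (Nat.card N : ℂ) ≠ 0 := by exact_mod_cast (Nat.card_pos (α := N)).ne'
  have hι1 : ι 1 = 1 := by
    have h := hι 1 1
    rw [mul_one] at h
    exact mul_eq_left.1 h.symm
  have hιinv : ∀ g, ι g⁻¹ = (ι g)⁻¹ := fun g =>
    eq_inv_of_mul_eq_one_left (by rw [← hι, mul_inv_cancel, hι1])
  refine (endToHecke_bijective ψ).1 (Subtype.ext (funext fun g => mul_left_cancel₀ hcard ?_))
  change (Nat.card N : ℂ) * (S (T (extendByZero ψ))).1 g =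
    (Nat.card N : ℂ) * (T (S (extendByZero ψ))).1 g
  have hTS : (T (S (extendByZero ψ))).1 ∈ heckeSpace ψ := map_extendByZero_mem ψ (T * S)
  have hS := map_extendByZero_mem ψ S
  have hT := map_extendByZero_mem ψ T
  -- The substitution x ↦ ι(g x⁻¹) exchanges the two factors of the convolution, up to applying `ι`,
  -- which `hfix` removes.
  let e : G ≃ G := (ι.trans (Equiv.inv G)).trans (Equiv.mulRight (ι g))
  have he : ∀ x, e x = ι (g * x⁻¹) := fun x => by simp [e, hι, hιinv]
  have he' : ∀ x, ι g * (e x)⁻¹ = ι x := fun x => by simp [e]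
  rw [← hfix _ hTS g, card_mul_apply, card_mul_apply]
  refine Eq.trans (Finset.sum_congr rfl fun x _ => ?_) (Equiv.sum_comp e _)
  rw [he', he, hfix _ hS, hfix _ hT, mul_comm]

end Representation

/-! ### Relevant double cosets. -/

namespace Representation

open Module

variable {G : Type*} [Group G] {N : Subgroup G} {ψ : N →* ℂ}

theorem heckeSpace_eq_zero_of_mul_eq_zero {φ : G → ℂ} (hφ : φ ∈ heckeSpace ψ) {n n' : N} {g : G}
    (h : φ (n * g * n') = 0) : φ g = 0 := by
  have hn : ∀ m : N, ψ m ≠ 0 := fun m => (Group.isUnit m).map ψ |>.ne_zero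
  rw [hφ n n' g] at h
  simpa [hn] using h

/-- Evaluating `φ` on both sides gives `ψ n * φ g = φ g * ψ n'`. This is the only mechanism by which
cosets are excluded below. -/
theorem heckeSpace_eq_zero_of_mul_eq_mul {φ : G → ℂ} (hφ : φ ∈ heckeSpace ψ) {n n' : N} {g : G}
    (h : n * g = g * n') (hne : ψ n ≠ ψ n') : φ g = 0 := by
  have h' := congrArg φ h
  rw [heckeSpace_left hφ, heckeSpace_right hφ, mul_comm] at h'
  by_contra h0
  exact hne (mul_left_cancel₀ h0 h')

/-- The dimension of the space of functions transforming on both sides by `ψ` is the number of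
relevant double cosets. -/
theorem finrank_heckeSpace [Finite G] {X : Type*} [Fintype X] (r : X → G)
    (hzero : ∀ φ ∈ heckeSpace ψ, (∀ x, φ (r x) = 0) → ∀ g, φ g = 0)
    (hrel : ∀ (x x' : X) (n n' : N), n * r x * n' = r x' → x = x' ∧ ψ n * ψ n' = 1) :
    finrank ℂ (heckeSpace ψ) = Fintype.card X := by
  classical
  have : Fintype N := Fintype.ofFinite N
  let res : heckeSpace ψ →ₗ[ℂ] (X → ℂ) :=
    { toFun := fun φ x => φ.1 (r x), map_add' := fun _ _ => rfl, map_smul' := fun _ _ => rfl }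
  -- The `ψ`-twisted indicator of the double coset of `r x`. At `r x` itself every contributing pair
  -- has weight 1 by `hrel`, so the value is the number of such pairs, and `(1, 1)` is one.
  let δ : X → G → ℂ := fun x g => ∑ p : N × N, if p.1 * r x * p.2 = g then ψ p.1 * ψ p.2 else 0
  have hδ : ∀ x, δ x ∈ heckeSpace ψ := by
    intro x m m' g
    change ∑ p : N × N, _ = ψ m * (∑ p : N × N, _) * ψ m'
    rw [Finset.mul_sum, Finset.sum_mul,
      ← Equiv.sum_comp ((Equiv.mulLeft m).prodCongr (Equiv.mulRight m'))]
    refine Finset.sum_congr rfl fun p _ => ?_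
    have hiff : ((m * p.1 : N) : G) * r x * ((p.2 * m' : N) : G) = m * g * m' ↔
        p.1 * r x * p.2 = g := by
      rw [Subgroup.coe_mul, Subgroup.coe_mul, ← mul_assoc, mul_left_inj, mul_assoc (m : G),
        mul_assoc (m : G), mul_right_inj]
    simp only [Equiv.prodCongr_apply, Prod.map, Equiv.coe_mulLeft, Equiv.coe_mulRight, hiff,
      map_mul]
    split_ifs <;> ring
  have hδne : ∀ x x', x ≠ x' → δ x (r x') = 0 := fun x x' hx =>
    Finset.sum_eq_zero fun p _ => if_neg fun h => hx (hrel _ _ _ _ h).1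
  have hδself : ∀ x, δ x (r x) ≠ 0 := by
    intro x
    have h : δ x (r x) = ∑ p : N × N, if p.1 * r x * p.2 = r x then (1 : ℂ) else 0 :=
      Finset.sum_congr rfl fun p _ => by
        split_ifs with h
        · exact (hrel _ _ _ _ h).2
        · rfl
    rw [h, ← Finset.sum_filter, Finset.sum_const, nsmul_eq_mul, mul_one, Nat.cast_ne_zero]
    exact Finset.card_ne_zero_of_mem (a := (1, 1)) (by simp)
  have hbij : Function.Bijective res := by
    refine ⟨(injective_iff_map_eq_zero res).2 fun φ h => ?_, fun f => ?_⟩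
    · exact Subtype.ext (funext (hzero φ.1 φ.2 fun x => congrFun h x))
    · refine ⟨∑ x, (f x / δ x (r x)) • ⟨δ x, hδ x⟩, funext fun x => ?_⟩
      rw [map_sum, Finset.sum_apply, Finset.sum_eq_single x]
      · change f x / δ x (r x) * δ x (r x) = f x
        exact div_mul_cancel₀ _ (hδself x)
      · intro y _ hy
        change f y / δ y (r y) * δ y (r x) = 0
        rw [hδne y x hy, mul_zero]
      · simp
  rw [(LinearEquiv.ofBijective res hbij).finrank_eq, finrank_fintype_fun_eq_card]

/-- An anti-automorphism preserving `ψ` and fixing representatives of the relevant double cosets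
fixes all functions transforming on both sides by `ψ`. -/
theorem heckeSpace_apply_antiautomorphism {X : Type*} (r : X → G)
    (hzero : ∀ φ ∈ heckeSpace ψ, (∀ x, φ (r x) = 0) → ∀ g, φ g = 0)
    (ι : G → G) (hι : ∀ g h, ι (g * h) = ι h * ι g) (hr : ∀ x, ι (r x) = r x)
    (hN : ∀ n : N, ∃ m : N, ι n = m ∧ ψ m = ψ n) {φ : G → ℂ} (hφ : φ ∈ heckeSpace ψ) (g : G) :
    φ (ι g) = φ g := by
  have hφι : φ ∘ ι ∈ heckeSpace ψ := by
    intro n n' g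
    obtain ⟨m, hm, hψ⟩ := hN n
    obtain ⟨m', hm', hψ'⟩ := hN n'
    simp only [Function.comp_apply, hι, hm, hm']
    rw [← mul_assoc, hφ, hψ, hψ']
    ring
  -- `φ ∘ ι - φ` transforms by `ψ` and vanishes at the representatives.
  have h := hzero _ ((heckeSpace ψ).sub_mem hφι hφ)
    (fun x => by simp [hr]) g
  exact sub_eq_zero.1 h

end Representation

open Representation

/-! ### Coordinates on GSp(4) and `N`, and the anti-involution. -/

section

variable {F : Type*} [Field F]

theorem Fin.forall_fin_four {P : Fin 4 → Prop} : (∀ i, P i) ↔ P 0 ∧ P 1 ∧ P 2 ∧ P 3 := by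
  simp [Fin.forall_fin_succ]

theorem GSp4.ext_entry {g h : GSp4 F} (H : ∀ i j, gspEntry g i j = gspEntry h i j) : g = h :=
  Subtype.ext (Units.ext (Matrix.ext H))

theorem formJ_mul_self : formJ F * formJ F = -1 := by
  ext i j
  fin_cases i <;> fin_cases j <;> simp [formJ, Matrix.mul_apply, Fin.sum_univ_four]

/-- Since J² = -1, the symplectic relation itself exhibits the inverse. -/
theorem symplectic_left_inverse {M : Matrix (Fin 4) (Fin 4) F} {c : F} (hc : c ≠ 0)
    (h : M.transpose * formJ F * M = c • formJ F) :
    (-c⁻¹ • (formJ F * M.transpose * formJ F)) * M = 1 := by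
  rw [Matrix.smul_mul, Matrix.mul_assoc, Matrix.mul_assoc, ← Matrix.mul_assoc M.transpose, h,
    Matrix.mul_smul, formJ_mul_self, smul_smul, neg_mul, inv_mul_cancel₀ hc]
  simp

/-- The element of `GSp(4, F)` with a given matrix. -/
def GSp4.mk (M : Matrix (Fin 4) (Fin 4) F) (c : F) (hc : c ≠ 0)
    (h : M.transpose * formJ F * M = c • formJ F) : GSp4 F :=
  ⟨⟨M, -c⁻¹ • (formJ F * M.transpose * formJ F),
    mul_eq_one_comm.1 (symplectic_left_inverse hc h), symplectic_left_inverse hc h⟩,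
    Units.mk0 c hc, h⟩

theorem gspEntry_mk (M : Matrix (Fin 4) (Fin 4) F) (c : F) (hc : c ≠ 0)
    (h : M.transpose * formJ F * M = c • formJ F) (i j : Fin 4) :
    gspEntry (GSp4.mk M c hc h) i j = M i j := rfl

/-- The relation between the columns of an element of `GSp(4, F)` also holds between its rows. -/
theorem symplectic_transpose {M : Matrix (Fin 4) (Fin 4) F} {c : F} (hc : c ≠ 0)
    (h : M.transpose * formJ F * M = c • formJ F) :
    M * formJ F * M.transpose = c • formJ F := by
  have h1 := mul_eq_one_comm.1 (symplectic_left_inverse hc h)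
  rw [Matrix.mul_smul] at h1
  have h2 := congrArg (fun A => (c : F) • (A * formJ F)) h1
  simp only [Matrix.smul_mul, smul_smul, Matrix.mul_assoc, formJ_mul_self, one_mul] at h2
  rw [mul_neg, mul_inv_cancel₀ hc] at h2
  simpa [Matrix.mul_assoc] using h2

/-- The equations satisfied by the entries of an element of `GSp(4, F)`. -/
theorem GSp4.exists_relations (g : GSp4 F) : ∃ c : F, c ≠ 0 ∧
    (∀ j k, gspEntry g 0 j * gspEntry g 3 k + gspEntry g 1 j * gspEntry g 2 k
      - gspEntry g 2 j * gspEntry g 1 k - gspEntry g 3 j * gspEntry g 0 k = c * formJ F j k) ∧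
    (∀ j k, gspEntry g j 0 * gspEntry g k 3 + gspEntry g j 1 * gspEntry g k 2
      - gspEntry g j 2 * gspEntry g k 1 - gspEntry g j 3 * gspEntry g k 0 = c * formJ F j k) := by
  obtain ⟨c, hc⟩ := g.2
  refine ⟨c, c.ne_zero, fun j k => ?_, fun j k => ?_⟩
  · have h := congrFun (congrFun hc j) k
    simp only [Matrix.mul_apply, Matrix.smul_apply, smul_eq_mul, Fin.sum_univ_four,
      Matrix.transpose_apply] at h
    rw [← h]
    simp [formJ, gspEntry]
    ring
  · have h := congrFun (congrFun (symplectic_transpose c.ne_zero hc) j) k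
    simp only [Matrix.mul_apply, Matrix.smul_apply, smul_eq_mul, Fin.sum_univ_four,
      Matrix.transpose_apply] at h
    rw [← h]
    simp [formJ, gspEntry]
    ring

/-- The elements of `N`, in coordinates. -/
def unipotentElt (y x z w : F) : unipotentN F :=
  -- The entries `z - x * y` and `-y` are forced by the form.
  ⟨GSp4.mk !![1, y, z, w; 0, 1, x, z - x * y; 0, 0, 1, -y; 0, 0, 0, 1] 1 one_ne_zero (by
    ext i j
    fin_cases i <;> fin_cases j <;>
      simp [formJ, Matrix.mul_apply, Fin.sum_univ_four] <;> ring), by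
    refine ⟨?_, ?_⟩
    · simp [Fin.forall_fin_four, gspEntry_mk]
    · simp [Fin.forall_fin_four, gspEntry_mk]⟩

section

variable (y x z w : F) (g : GSp4 F) (i j : Fin 4)

@[simp] theorem unipotentElt_mul_zero : gspEntry ((unipotentElt y x z w : GSp4 F) * g) 0 j =
    gspEntry g 0 j + y * gspEntry g 1 j + z * gspEntry g 2 j + w * gspEntry g 3 j := by
  rw [gspEntry_mul, Fin.sum_univ_four]; simp [unipotentElt, gspEntry_mk]

@[simp] theorem unipotentElt_mul_one : gspEntry ((unipotentElt y x z w : GSp4 F) * g) 1 j =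
    gspEntry g 1 j + x * gspEntry g 2 j + (z - x * y) * gspEntry g 3 j := by
  rw [gspEntry_mul, Fin.sum_univ_four]; simp [unipotentElt, gspEntry_mk]

@[simp] theorem unipotentElt_mul_two : gspEntry ((unipotentElt y x z w : GSp4 F) * g) 2 j =
    gspEntry g 2 j - y * gspEntry g 3 j := by
  rw [gspEntry_mul, Fin.sum_univ_four]; simp [unipotentElt, gspEntry_mk]; ring

@[simp] theorem unipotentElt_mul_three : gspEntry ((unipotentElt y x z w : GSp4 F) * g) 3 j =
    gspEntry g 3 j := by
  rw [gspEntry_mul, Fin.sum_univ_four]; simp [unipotentElt, gspEntry_mk]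

@[simp] theorem mul_unipotentElt_zero : gspEntry (g * (unipotentElt y x z w : GSp4 F)) i 0 =
    gspEntry g i 0 := by
  rw [gspEntry_mul, Fin.sum_univ_four]; simp [unipotentElt, gspEntry_mk]

@[simp] theorem mul_unipotentElt_one : gspEntry (g * (unipotentElt y x z w : GSp4 F)) i 1 =
    gspEntry g i 0 * y + gspEntry g i 1 := by
  rw [gspEntry_mul, Fin.sum_univ_four]; simp [unipotentElt, gspEntry_mk]

@[simp] theorem mul_unipotentElt_two : gspEntry (g * (unipotentElt y x z w : GSp4 F)) i 2 =
    gspEntry g i 0 * z + gspEntry g i 1 * x + gspEntry g i 2 := by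
  rw [gspEntry_mul, Fin.sum_univ_four]; simp [unipotentElt, gspEntry_mk]

@[simp] theorem mul_unipotentElt_three : gspEntry (g * (unipotentElt y x z w : GSp4 F)) i 3 =
    gspEntry g i 0 * w + gspEntry g i 1 * (z - x * y) - gspEntry g i 2 * y + gspEntry g i 3 := by
  rw [gspEntry_mul, Fin.sum_univ_four]; simp [unipotentElt, gspEntry_mk]; ring

@[simp] theorem psiN_unipotentElt (ψ₁ ψ₂ : AddChar F ℂ) :
    psiN ψ₁ ψ₂ (unipotentElt y x z w) = ψ₁ x * ψ₂ y := rfl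

end

theorem unipotentN_entry_two_three (n : unipotentN F) :
    gspEntry (n : GSp4 F) 2 3 = -gspEntry (n : GSp4 F) 0 1 := by
  obtain ⟨⟨g, hg⟩, hl, hd⟩ := n
  obtain ⟨c, hc, hcol, -⟩ := GSp4.exists_relations ⟨g, hg⟩
  have h := hcol 1 3
  simp [hl 3 1 (by decide), hl 2 1 (by decide), hd, formJ] at h
  linear_combination h

theorem exists_eq_unipotentElt (n : unipotentN F) : ∃ y x z w, n = unipotentElt y x z w := by
  have h23 := unipotentN_entry_two_three n
  have hl := n.2.1
  have hd := n.2.2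
  obtain ⟨c, hc, hcol, -⟩ := GSp4.exists_relations (n : GSp4 F)
  have h := hcol 2 3
  refine ⟨gspEntry (n : GSp4 F) 0 1, gspEntry (n : GSp4 F) 1 2, gspEntry (n : GSp4 F) 0 2,
    gspEntry (n : GSp4 F) 0 3, Subtype.ext (GSp4.ext_entry ?_)⟩
  simp [hl 3 2 (by decide), hd, formJ, h23] at h
  rw [Fin.forall_fin_four]
  simp only [Fin.forall_fin_four]
  simp [unipotentElt, gspEntry_mk, hd, h23, hl 1 0 (by decide), hl 2 0 (by decide),
    hl 2 1 (by decide), hl 3 0 (by decide), hl 3 1 (by decide), hl 3 2 (by decide)]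
  linear_combination -h

/-- The matrix conjugating the transpose of an element of `GSp(4, F)` to its image under the
anti-involution. -/
def flipMatrix (F : Type*) [Field F] : Matrix (Fin 4) (Fin 4) F :=
  !![0, 0, 0, 1;
     0, 0, -1, 0;
     0, -1, 0, 0;
     1, 0, 0, 0]

theorem flipMatrix_mul_self : flipMatrix F * flipMatrix F = 1 := by
  ext i j
  fin_cases i <;> fin_cases j <;> simp [flipMatrix, Matrix.mul_apply, Fin.sum_univ_four]

theorem flipMatrix_transpose : (flipMatrix F).transpose = flipMatrix F := by
  ext i j
  fin_cases i <;> fin_cases j <;> simp [flipMatrix]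

theorem flipMatrix_conj_formJ : flipMatrix F * (formJ F * flipMatrix F) = -formJ F := by
  ext i j
  fin_cases i <;> fin_cases j <;> simp [flipMatrix, formJ, Matrix.mul_apply, Fin.sum_univ_four]

theorem flipMatrix_mul_cancel_left (A : Matrix (Fin 4) (Fin 4) F) :
    flipMatrix F * (flipMatrix F * A) = A := by
  rw [← Matrix.mul_assoc, flipMatrix_mul_self, Matrix.one_mul]

/-- The anti-involution `g ↦ E ᵗg E` of `GSp(4, F)`. -/
def antiInvolution (g : GSp4 F) : GSp4 F :=
  ⟨⟨flipMatrix F * ((g : GL (Fin 4) F) : Matrix (Fin 4) (Fin 4) F).transpose * flipMatrix F,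
    flipMatrix F * (((g : GL (Fin 4) F)⁻¹ : GL (Fin 4) F) : Matrix (Fin 4) (Fin 4) F).transpose *
      flipMatrix F, by
      simp only [Matrix.mul_assoc, flipMatrix_mul_cancel_left]
      rw [← Matrix.mul_assoc (Matrix.transpose _), ← Matrix.transpose_mul, ← Units.val_mul,
        inv_mul_cancel, Units.val_one, Matrix.transpose_one, Matrix.one_mul,
        flipMatrix_mul_self], by
      simp only [Matrix.mul_assoc, flipMatrix_mul_cancel_left]
      rw [← Matrix.mul_assoc (Matrix.transpose _), ← Matrix.transpose_mul, ← Units.val_mul,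
        mul_inv_cancel, Units.val_one, Matrix.transpose_one, Matrix.one_mul,
        flipMatrix_mul_self]⟩, by
    obtain ⟨c, hc⟩ := g.2
    refine ⟨c, ?_⟩
    have h := symplectic_transpose c.ne_zero hc
    simp only [Matrix.transpose_mul, flipMatrix_transpose, Matrix.transpose_transpose]
    set M := ((g : GL (Fin 4) F) : Matrix (Fin 4) (Fin 4) F)
    calc _ = flipMatrix F * (M * (flipMatrix F * (formJ F * flipMatrix F)) * M.transpose) *
          flipMatrix F := by simp only [Matrix.mul_assoc]
      _ = -(c : F) • (flipMatrix F * (formJ F * flipMatrix F)) := by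
          rw [flipMatrix_conj_formJ, Matrix.mul_neg, Matrix.neg_mul, h]
          simp [Matrix.mul_assoc, flipMatrix_conj_formJ]
      _ = _ := by rw [flipMatrix_conj_formJ]; simp⟩

theorem antiInvolution_coe (g : GSp4 F) :
    ((antiInvolution g : GL (Fin 4) F) : Matrix (Fin 4) (Fin 4) F) =
      flipMatrix F * ((g : GL (Fin 4) F) : Matrix (Fin 4) (Fin 4) F).transpose * flipMatrix F :=
  rfl

theorem antiInvolution_mul (g h : GSp4 F) :
    antiInvolution (g * h) = antiInvolution h * antiInvolution g := by
  refine Subtype.ext (Units.ext ?_)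
  rw [Subgroup.coe_mul, Units.val_mul]
  simp only [antiInvolution_coe, Subgroup.coe_mul, Units.val_mul, Matrix.transpose_mul,
    Matrix.mul_assoc, flipMatrix_mul_cancel_left]

theorem antiInvolution_involutive : Function.Involutive (antiInvolution (F := F)) := by
  intro g
  refine Subtype.ext (Units.ext ?_)
  simp only [antiInvolution_coe, Matrix.transpose_mul, Matrix.transpose_transpose,
    flipMatrix_transpose, Matrix.mul_assoc, flipMatrix_mul_cancel_left, flipMatrix_mul_self,
    Matrix.mul_one]

theorem gspEntry_antiInvolution (g : GSp4 F) (i j : Fin 4) :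
    gspEntry (antiInvolution g) i j =
      flipMatrix F i i.rev * gspEntry g j.rev i.rev * flipMatrix F j.rev j := by
  rw [gspEntry, antiInvolution_coe]
  simp only [Matrix.mul_apply, Fin.sum_univ_four, Matrix.transpose_apply, gspEntry]
  fin_cases i <;> fin_cases j <;> simp [flipMatrix, Fin.rev]

/-- With the signs in `flipMatrix`, entry `(1, 2)` is kept and entry `(0, 1)` becomes minus entry
`(2, 3)`, which is the old entry `(0, 1)`. -/
theorem antiInvolution_mem_unipotentN (ψ₁ ψ₂ : AddChar F ℂ) (n : unipotentN F) :
    ∃ m : unipotentN F, antiInvolution (n : GSp4 F) = m ∧ psiN ψ₁ ψ₂ m = psiN ψ₁ ψ₂ n := by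
  have h23 := unipotentN_entry_two_three n
  have hl := n.2.1
  have hd := n.2.2
  refine ⟨⟨antiInvolution n, fun i j hij => ?_, ?_⟩, rfl, ?_⟩
  · rw [gspEntry_antiInvolution, hl _ _ (Fin.rev_lt_rev.2 hij)]
    ring
  · rw [Fin.forall_fin_four]
    simp [gspEntry_antiInvolution, hd, flipMatrix, Fin.rev]
  · change ψ₁ (gspEntry (antiInvolution (n : GSp4 F)) 1 2) *
      ψ₂ (gspEntry (antiInvolution (n : GSp4 F)) 0 1) = _
    rw [gspEntry_antiInvolution, gspEntry_antiInvolution]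
    have e1 : Fin.rev (1 : Fin 4) = 2 := rfl
    have e2 : Fin.rev (2 : Fin 4) = 1 := rfl
    have e0 : Fin.rev (0 : Fin 4) = 3 := rfl
    rw [e0, e1, e2, h23]
    simp [flipMatrix, psiN]

theorem AddChar.exists_mul_ne_mul {ψ : AddChar F ℂ} (hψ : ψ ≠ 1) {a b : F} (hab : a ≠ b) :
    ∃ t, ψ (a * t) ≠ ψ (b * t) := by
  obtain ⟨x, hx⟩ := AddChar.ne_one_iff.1 hψ
  have hab' : a - b ≠ 0 := sub_ne_zero.2 hab
  -- Chosen so that `a * t = b * t + x`, with `ψ x ≠ 1`.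
  refine ⟨x / (a - b), fun h => hx ?_⟩
  have e : a * (x / (a - b)) = b * (x / (a - b)) + x := by field_simp; ring
  rw [e, AddChar.map_add_eq_mul] at h
  have hu : ψ (b * (x / (a - b))) ≠ 0 := by
    intro h0
    have h1 : ψ (b * (x / (a - b)) + -(b * (x / (a - b)))) = 0 := by
      rw [AddChar.map_add_eq_mul, h0, zero_mul]
    rw [add_neg_cancel, AddChar.map_zero_eq_one] at h1
    exact one_ne_zero h1
  exact mul_eq_left₀ hu |>.1 h

/-! ### Representatives of the relevant double cosets. -/

/-- The scalar matrix `a`. -/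
def scalarElt (a : Fˣ) : GSp4 F :=
  GSp4.mk !![(a : F), 0, 0, 0; 0, a, 0, 0; 0, 0, a, 0; 0, 0, 0, a] (a * a) (by simp) (by
    ext i j
    fin_cases i <;> fin_cases j <;>
      simp [formJ, Matrix.mul_apply, Fin.sum_univ_four])

/-- The relevant representatives in the Siegel parabolic cell. -/
def siegelElt (a c : Fˣ) : GSp4 F :=
  -- The opposite signs make conjugation preserve the coordinate `y`, as compatibility with `ψ₂`
  -- requires.
  GSp4.mk !![0, 0, (a : F), 0; 0, 0, 0, -(a : F); (c : F), 0, 0, 0; 0, -(c : F), 0, 0]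
    (a * c) (by simp) (by
    ext i j
    fin_cases i <;> fin_cases j <;>
      simp [formJ, Matrix.mul_apply, Fin.sum_univ_four, mul_comm])

/-- The relevant representatives in the Klingen parabolic cell. -/
def klingenElt (b c : Fˣ) : GSp4 F :=
  -- Equal middle entries make conjugation preserve `x`; the corner entry is forced by the
  -- multiplier.
  GSp4.mk !![0, 0, 0, -(c * c / b : F); 0, (c : F), 0, 0; 0, 0, (c : F), 0; (b : F), 0, 0, 0]
    (c * c) (by simp) (by
    ext i j
    fin_cases i <;> fin_cases j <;>
      simp [formJ, Matrix.mul_apply, Fin.sum_univ_four]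
    all_goals field_simp)

/-- The representatives in the big cell. -/
def bigCellElt (b c d : Fˣ) : GSp4 F :=
  GSp4.mk !![0, 0, 0, (b * c / d : F); 0, 0, (b : F), 0; 0, (c : F), 0, 0; (d : F), 0, 0, 0]
    (-(b * c)) (by simp) (by
    ext i j
    fin_cases i <;> fin_cases j <;>
      simp [formJ, Matrix.mul_apply, Fin.sum_univ_four] <;> field_simp)

/-- Representatives of the relevant double cosets. -/
def relevantElt : Fˣ ⊕ (Fˣ × Fˣ) ⊕ (Fˣ × Fˣ) ⊕ (Fˣ × Fˣ × Fˣ) → GSp4 F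
  | .inl a => scalarElt a
  | .inr (.inl (a, c)) => siegelElt a c
  | .inr (.inr (.inl (b, c))) => klingenElt b c
  | .inr (.inr (.inr (b, c, d))) => bigCellElt b c d

theorem antiInvolution_relevantElt (x : Fˣ ⊕ (Fˣ × Fˣ) ⊕ (Fˣ × Fˣ) ⊕ (Fˣ × Fˣ × Fˣ)) :
    antiInvolution (relevantElt x) = relevantElt x := by
  refine GSp4.ext_entry ?_
  rw [Fin.forall_fin_four]
  simp only [Fin.forall_fin_four]
  rcases x with a | ⟨a, c⟩ | ⟨b, c⟩ | ⟨b, c, d⟩ <;>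
    simp [gspEntry_antiInvolution, flipMatrix, Fin.rev, relevantElt, scalarElt, siegelElt,
      klingenElt, bigCellElt, gspEntry_mk]

/-- Comparing entries of `n * r = r' * n'⁻¹` recovers the torus parameters. Each of the coordinates
`x` and `y` either agrees in `n` and `n'⁻¹` or vanishes in both, so `ψ_N` takes the same value;
different cells have incompatible zero patterns. -/
theorem relevantElt_unique (ψ₁ ψ₂ : AddChar F ℂ)
    (a a' : Fˣ ⊕ (Fˣ × Fˣ) ⊕ (Fˣ × Fˣ) ⊕ (Fˣ × Fˣ × Fˣ)) (n n' : unipotentN F)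
    (h : n * relevantElt a * n' = relevantElt a') :
    a = a' ∧ psiN ψ₁ ψ₂ n * psiN ψ₁ ψ₂ n' = 1 := by
  have h' : (n : GSp4 F) * relevantElt a = relevantElt a' * (n'⁻¹ : unipotentN F) := by
    rw [← h]; simp
  suffices a = a' ∧ psiN ψ₁ ψ₂ n = psiN ψ₁ ψ₂ n'⁻¹ by
    refine ⟨this.1, ?_⟩
    rw [this.2, ← map_mul, inv_mul_cancel, map_one]
  obtain ⟨y, x, z, w, rfl⟩ := exists_eq_unipotentElt n
  obtain ⟨y', x', z', w', hn'⟩ := exists_eq_unipotentElt n'⁻¹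
  rw [hn'] at h' ⊢
  have H : ∀ i j, gspEntry ((unipotentElt y x z w : GSp4 F) * relevantElt a) i j =
    gspEntry (relevantElt a' * (unipotentElt y' x' z' w' : GSp4 F)) i j := fun i j => by rw [h']
  rw [Fin.forall_fin_four] at H
  simp only [Fin.forall_fin_four] at H
  clear h h' hn'
  rcases a with a | ⟨a, c⟩ | ⟨b, c⟩ | ⟨b, c, d⟩ <;>
  rcases a' with a' | ⟨a', c'⟩ | ⟨b', c'⟩ | ⟨b', c', d'⟩ <;>
    simp [relevantElt, scalarElt, siegelElt, klingenElt, bigCellElt, gspEntry_mk] at H ⊢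
  · obtain ⟨⟨ha, hy, -⟩, ⟨-, hx, -⟩, -⟩ := H
    obtain rfl := Units.ext ha
    rw [mul_comm] at hy hx
    rw [mul_left_cancel₀ a.ne_zero hy, mul_left_cancel₀ a.ne_zero hx]
    exact ⟨rfl, rfl⟩
  · obtain ⟨⟨-, -, ha, -⟩, ⟨hx, -⟩, ⟨hc, hy, -⟩, -, hx', -⟩ := H
    obtain rfl := Units.ext ha
    obtain rfl := Units.ext hc
    rw [mul_comm] at hy
    rw [mul_left_cancel₀ c.ne_zero hy, hx, hx']
    exact ⟨⟨rfl, rfl⟩, rfl⟩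
  · obtain ⟨⟨-, hy, -⟩, ⟨-, hc, hx, -⟩, -, hb, hy', -⟩ := H
    obtain rfl := Units.ext hb
    obtain rfl := Units.ext hc
    rw [mul_comm] at hx
    rw [mul_left_cancel₀ c.ne_zero hx, hy, hy']
    exact ⟨⟨rfl, rfl⟩, rfl⟩
  · obtain ⟨-, ⟨-, hx, hb, hy'⟩, ⟨hy, hc, hx', -⟩, hd, -⟩ := H
    rw [Units.ext hb, Units.ext hc, Units.ext hd, hx, hy, hx', hy']
    exact ⟨⟨rfl, rfl, rfl⟩, rfl⟩

/-! ### Reduction of an arbitrary element to a representative. -/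

theorem GSp4.ext_entry_and {g h : GSp4 F}
    (H : (gspEntry g 0 0 = gspEntry h 0 0 ∧ gspEntry g 0 1 = gspEntry h 0 1 ∧
        gspEntry g 0 2 = gspEntry h 0 2 ∧ gspEntry g 0 3 = gspEntry h 0 3) ∧
      (gspEntry g 1 0 = gspEntry h 1 0 ∧ gspEntry g 1 1 = gspEntry h 1 1 ∧
        gspEntry g 1 2 = gspEntry h 1 2 ∧ gspEntry g 1 3 = gspEntry h 1 3) ∧
      (gspEntry g 2 0 = gspEntry h 2 0 ∧ gspEntry g 2 1 = gspEntry h 2 1 ∧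
        gspEntry g 2 2 = gspEntry h 2 2 ∧ gspEntry g 2 3 = gspEntry h 2 3) ∧
      (gspEntry g 3 0 = gspEntry h 3 0 ∧ gspEntry g 3 1 = gspEntry h 3 1 ∧
        gspEntry g 3 2 = gspEntry h 3 2 ∧ gspEntry g 3 3 = gspEntry h 3 3)) : g = h := by
  refine GSp4.ext_entry ?_
  rw [Fin.forall_fin_four]
  simp only [Fin.forall_fin_four]
  exact H

section

variable {ψ₁ ψ₂ : AddChar F ℂ} {φ : GSp4 F → ℂ}

theorem heckeSpace_eq_zero_of_left (hφ : φ ∈ heckeSpace (psiN ψ₁ ψ₂)) (n : unipotentN F)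
    {g : GSp4 F} (h : φ (n * g) = 0) : φ g = 0 :=
  heckeSpace_eq_zero_of_mul_eq_zero hφ (n := n) (n' := 1) (by simpa using h)

theorem heckeSpace_eq_zero_of_right (hφ : φ ∈ heckeSpace (psiN ψ₁ ψ₂)) (n : unipotentN F)
    {g : GSp4 F} (h : φ (g * n) = 0) : φ g = 0 :=
  heckeSpace_eq_zero_of_mul_eq_zero hφ (n := 1) (n' := n) (by simpa using h)

theorem AddChar.exists_mul_ne_one {ψ : AddChar F ℂ} (hψ : ψ ≠ 1) {a : F} (ha : a ≠ 0) :
    ∃ t, ψ (a * t) ≠ 1 := by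
  obtain ⟨t, ht⟩ := AddChar.exists_mul_ne_mul hψ ha
  exact ⟨t, by simpa using ht⟩

theorem eq_zero_of_row_three_pos_two (hψ₁ : ψ₁ ≠ 1) (hφ : φ ∈ heckeSpace (psiN ψ₁ ψ₂))
    (g : GSp4 F) (h0 : gspEntry g 3 0 = 0) (h1 : gspEntry g 3 1 = 0)
    (h2 : gspEntry g 3 2 ≠ 0) : φ g = 0 := by
  obtain ⟨c, hc, -, hrow⟩ := GSp4.exists_relations g
  obtain ⟨t, ht⟩ := AddChar.exists_mul_ne_one hψ₁ (mul_ne_zero h2 h2)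
  have r0 := hrow 0 3
  have r1 := hrow 1 3
  have r2 := hrow 2 3
  simp [formJ, h0, h1] at r0 r1 r2
  -- Here `n'` is the conjugate of `n` by `g`, a transvection built from the last row of `g`. `ψ_N`
  -- is trivial on `n`, while the `x`-coordinate of `n'` is a nonzero square times `t`.
  refine heckeSpace_eq_zero_of_mul_eq_mul hφ (n := unipotentElt 0 0 0 (c * t))
    (n' := unipotentElt 0 (gspEntry g 3 2 * gspEntry g 3 2 * t)
      (gspEntry g 3 2 * gspEntry g 3 3 * t) (gspEntry g 3 3 * gspEntry g 3 3 * t))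
    (GSp4.ext_entry_and ?_) (by simpa using ht.symm)
  simp [h0, h1]
  refine ⟨⟨?_, ?_⟩, ⟨?_, ?_⟩, ?_, ?_⟩
  · linear_combination -(gspEntry g 3 2 * t) * r0
  · linear_combination -(gspEntry g 3 3 * t) * r0
  · linear_combination gspEntry g 3 2 * t * r1
  · linear_combination gspEntry g 3 3 * t * r1
  · linear_combination gspEntry g 3 2 * t * r2
  · linear_combination gspEntry g 3 3 * t * r2

/-- An upper triangular block matrix with lower left middle entry nonzero is irrelevant. -/
theorem eq_zero_of_row_three_pos_three_of_ne (hψ₂ : ψ₂ ≠ 1)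
    (hφ : φ ∈ heckeSpace (psiN ψ₁ ψ₂))
    (g : GSp4 F) (h0 : gspEntry g 3 0 = 0) (h1 : gspEntry g 3 1 = 0)
    (h2 : gspEntry g 3 2 = 0) (h21 : gspEntry g 2 1 ≠ 0) : φ g = 0 := by
  obtain ⟨c, hc, hcol, hrow⟩ := GSp4.exists_relations g
  have r0 := hrow 0 3
  have r1 := hrow 1 3
  have r2 := hrow 2 3
  have c1 := hcol 1 2
  simp [formJ, h0, h1, h2] at r0 r1 r2 c1
  have h3 : gspEntry g 3 3 ≠ 0 := by
    intro h
    rw [h, mul_zero] at r0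
    exact hc r0.symm
  have h10 : gspEntry g 1 0 = 0 := r1.resolve_right h3
  have h20 : gspEntry g 2 0 = 0 := r2.resolve_right h3
  obtain ⟨t, ht⟩ := AddChar.exists_mul_ne_one hψ₂ (neg_ne_zero.2 h21)
  -- Conjugation stays inside the unipotent radical of the Klingen parabolic: `n'` has trivial
  -- character, `n` has `y`-coordinate `-gspEntry g 2 1 * t`, and its `w`-coordinate is solved from
  -- entry `(0, 3)`.
  refine heckeSpace_eq_zero_of_mul_eq_mul hφ
    (n := unipotentElt (-gspEntry g 2 1 * t) 0 (gspEntry g 1 1 * t)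
      ((gspEntry g 3 3 * t * gspEntry g 0 1 + gspEntry g 2 1 * t * gspEntry g 1 3 -
        gspEntry g 1 1 * t * gspEntry g 2 3) / gspEntry g 3 3))
    (n' := unipotentElt 0 0 (gspEntry g 3 3 * t) 0)
    (GSp4.ext_entry_and ?_) (by simpa using ht)
  simp [h0, h1, h2, h10, h20]
  refine ⟨⟨?_, ?_, ?_⟩, ?_, ?_⟩
  · ring
  · linear_combination t * (c1 - r0)
  · field_simp
    ring
  · ring
  · ring

/-- A diagonal matrix is central or irrelevant. -/
theorem eq_zero_of_diagonal (hψ₁ : ψ₁ ≠ 1) (hψ₂ : ψ₂ ≠ 1)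
    (hφ : φ ∈ heckeSpace (psiN ψ₁ ψ₂)) (hrel : ∀ x, φ (relevantElt x) = 0)
    (g : GSp4 F) (h : ∀ i j, i ≠ j → gspEntry g i j = 0) : φ g = 0 := by
  obtain ⟨c, hc, hcol, -⟩ := GSp4.exists_relations g
  have r0 := hcol 0 3
  have r1 := hcol 1 2
  simp [formJ, h 3 0 (by decide), h 2 1 (by decide), h 1 0 (by decide), h 2 0 (by decide),
    h 0 1 (by decide), h 3 1 (by decide)] at r0 r1
  have h3 : gspEntry g 0 0 ≠ 0 := by
    intro h
    rw [h, zero_mul] at r0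
    exact hc r0.symm
  have h1 : gspEntry g 1 1 ≠ 0 := by
    intro h
    rw [h, zero_mul] at r1
    exact hc r1.symm
  have h2 : gspEntry g 2 2 ≠ 0 := by
    intro h
    rw [h, mul_zero] at r1
    exact hc r1.symm
  -- Conjugation by a diagonal matrix rescales `y` and `x` by ratios of consecutive diagonal
  -- entries; unless both ratios are 1, one of the characters detects the rescaling.
  by_cases h01 : gspEntry g 1 1 = gspEntry g 0 0
  · by_cases h12 : gspEntry g 2 2 = gspEntry g 1 1
    · have h03 : gspEntry g 3 3 = gspEntry g 0 0 := by
        apply mul_left_cancel₀ h3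
        rw [r0, ← r1, h12, h01]
      have e : g = relevantElt (.inl (Units.mk0 _ h3)) := by
        refine GSp4.ext_entry_and ?_
        simp [relevantElt, scalarElt, gspEntry_mk, h, h01, h12, h03]
      rw [e]
      exact hrel _
    · obtain ⟨t, ht⟩ := AddChar.exists_mul_ne_mul hψ₁ h12
      refine heckeSpace_eq_zero_of_mul_eq_mul hφ (n := unipotentElt 0 (gspEntry g 1 1 * t) 0 0)
        (n' := unipotentElt 0 (gspEntry g 2 2 * t) 0 0)
        (GSp4.ext_entry_and ?_) (by simpa using ht.symm)
      simp [h]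
      ring
  · obtain ⟨t, ht⟩ := AddChar.exists_mul_ne_mul hψ₂ h01
    refine heckeSpace_eq_zero_of_mul_eq_mul hφ (n := unipotentElt (gspEntry g 0 0 * t) 0 0 0)
      (n' := unipotentElt (gspEntry g 1 1 * t) 0 0 0)
      (GSp4.ext_entry_and ?_) (by simpa using ht.symm)
    simp [h]
    exact ⟨by ring, by linear_combination t * (r0 - r1)⟩

/-- Right multiplication by `N` clears entries `(0, 1)`, `(1, 2)`, `(0, 2)`, `(0, 3)` through `y`,
`x`, `z`, `w`; the symplectic relations then clear `(1, 3)` and `(2, 3)`. -/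
theorem eq_zero_of_upperTriangular (hψ₁ : ψ₁ ≠ 1) (hψ₂ : ψ₂ ≠ 1)
    (hφ : φ ∈ heckeSpace (psiN ψ₁ ψ₂)) (hrel : ∀ x, φ (relevantElt x) = 0)
    (g : GSp4 F) (h : ∀ i j, j < i → gspEntry g i j = 0) : φ g = 0 := by
  obtain ⟨c, hc, hcol, -⟩ := GSp4.exists_relations g
  have r0 := hcol 0 3
  have r1 := hcol 1 2
  simp [formJ, h 3 0 (by decide), h 2 1 (by decide), h 1 0 (by decide), h 2 0 (by decide),
    h 3 1 (by decide), h 3 2 (by decide)] at r0 r1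
  have h0 : gspEntry g 0 0 ≠ 0 := by
    intro h
    rw [h, zero_mul] at r0
    exact hc r0.symm
  have h1 : gspEntry g 1 1 ≠ 0 := by
    intro h
    rw [h, zero_mul] at r1
    exact hc r1.symm
  have h2 : gspEntry g 2 2 ≠ 0 := by
    intro h
    rw [h, mul_zero] at r1
    exact hc r1.symm
  let y := -(gspEntry g 0 1 / gspEntry g 0 0)
  let x := -(gspEntry g 1 2 / gspEntry g 1 1)
  let z := -((gspEntry g 0 1 * x + gspEntry g 0 2) / gspEntry g 0 0)
  let w := -((gspEntry g 0 1 * (z - x * y) - gspEntry g 0 2 * y + gspEntry g 0 3) /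
    gspEntry g 0 0)
  refine heckeSpace_eq_zero_of_right hφ (unipotentElt y x z w) ?_
  have e22 : gspEntry (g * (unipotentElt y x z w : GSp4 F)) 2 2 ≠ 0 := by
    simpa [h 2 0 (by decide), h 2 1 (by decide)] using h2
  have e11 : gspEntry (g * (unipotentElt y x z w : GSp4 F)) 1 1 ≠ 0 := by
    simpa [h 1 0 (by decide)] using h1
  have e01 : gspEntry (g * (unipotentElt y x z w : GSp4 F)) 0 1 = 0 := by
    simp [y]; field_simp; ring
  have e02 : gspEntry (g * (unipotentElt y x z w : GSp4 F)) 0 2 = 0 := by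
    simp [z]; field_simp; ring
  have e03 : gspEntry (g * (unipotentElt y x z w : GSp4 F)) 0 3 = 0 := by
    simp [w]; field_simp; ring
  have e12 : gspEntry (g * (unipotentElt y x z w : GSp4 F)) 1 2 = 0 := by
    simp [x, h 1 0 (by decide)]; field_simp; ring
  have e10 : gspEntry (g * (unipotentElt y x z w : GSp4 F)) 1 0 = 0 := by
    simp [h 1 0 (by decide)]
  have e20 : gspEntry (g * (unipotentElt y x z w : GSp4 F)) 2 0 = 0 := by
    simp [h 2 0 (by decide)]
  have e21 : gspEntry (g * (unipotentElt y x z w : GSp4 F)) 2 1 = 0 := by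
    simp [h 2 0 (by decide), h 2 1 (by decide)]
  have e30 : gspEntry (g * (unipotentElt y x z w : GSp4 F)) 3 0 = 0 := by
    simp [h 3 0 (by decide)]
  have e31 : gspEntry (g * (unipotentElt y x z w : GSp4 F)) 3 1 = 0 := by
    simp [h 3 0 (by decide), h 3 1 (by decide)]
  have e32 : gspEntry (g * (unipotentElt y x z w : GSp4 F)) 3 2 = 0 := by
    simp [h 3 0 (by decide), h 3 1 (by decide), h 3 2 (by decide)]
  generalize g * (unipotentElt y x z w : GSp4 F) = g' at *
  obtain ⟨c', hc', hcol', -⟩ := GSp4.exists_relations g'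
  have r13 := hcol' 1 3
  have r23 := hcol' 2 3
  simp [formJ, e01, e02, e03, e12, e21, e31, e32, e11, e22] at r13 r23
  refine eq_zero_of_diagonal hψ₁ hψ₂ hφ hrel g' fun i j hij => ?_
  fin_cases i <;> fin_cases j <;> first | exact absurd rfl hij | assumption

theorem eq_zero_of_row_three_pos_three (hψ₁ : ψ₁ ≠ 1) (hψ₂ : ψ₂ ≠ 1)
    (hφ : φ ∈ heckeSpace (psiN ψ₁ ψ₂)) (hrel : ∀ x, φ (relevantElt x) = 0)
    (g : GSp4 F) (h0 : gspEntry g 3 0 = 0) (h1 : gspEntry g 3 1 = 0)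
    (h2 : gspEntry g 3 2 = 0) : φ g = 0 := by
  by_cases h21 : gspEntry g 2 1 = 0
  · obtain ⟨c, hc, hcol, hrow⟩ := GSp4.exists_relations g
    have r0 := hrow 0 3
    have r1 := hrow 1 3
    have r2 := hrow 2 3
    simp [formJ, h0, h1, h2] at r0 r1 r2
    have h3 : gspEntry g 3 3 ≠ 0 := by
      intro h
      rw [h, mul_zero] at r0
      exact hc r0.symm
    have h10 : gspEntry g 1 0 = 0 := r1.resolve_right h3
    have h20 : gspEntry g 2 0 = 0 := r2.resolve_right h3
    refine eq_zero_of_upperTriangular hψ₁ hψ₂ hφ hrel g fun i j hij => ?_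
    fin_cases i <;> fin_cases j <;> first | assumption | exact absurd hij (by decide)
  · exact eq_zero_of_row_three_pos_three_of_ne hψ₂ hφ g h0 h1 h2 h21

/-- Monomial matrices in the Siegel cell. -/
theorem eq_zero_of_siegel_monomial (hψ₂ : ψ₂ ≠ 1)
    (hφ : φ ∈ heckeSpace (psiN ψ₁ ψ₂)) (hrel : ∀ x, φ (relevantElt x) = 0)
    {g : GSp4 F} {a b c d : F} (h : ∀ i j, gspEntry g i j =
      !![0, 0, a, 0; 0, 0, 0, b; c, 0, 0, 0; 0, d, 0, 0] i j) : φ g = 0 := by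
  obtain ⟨m, hm, hcol, -⟩ := GSp4.exists_relations g
  have c12 := hcol 1 2
  have c03 := hcol 0 3
  simp [formJ, h] at c12 c03
  have ha : a ≠ 0 := by
    rintro rfl
    exact hm (by simpa using c12.symm)
  have hc : c ≠ 0 := by
    rintro rfl
    exact hm (by simpa using c03.symm)
  -- Conjugation carries the `y`-coordinate `a * t` to `-b * t`.
  by_cases hab : -b = a
  · have hd : d = -c := by
      apply mul_right_cancel₀ ha
      subst hab
      linear_combination c03 - c12
    have e : g = relevantElt (.inr (.inl (Units.mk0 a ha, Units.mk0 c hc))) := by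
      refine GSp4.ext_entry_and ?_
      simp [relevantElt, siegelElt, gspEntry_mk, h, hd, ← hab]
    rw [e]
    exact hrel _
  · obtain ⟨t, ht⟩ := AddChar.exists_mul_ne_mul hψ₂ hab
    refine heckeSpace_eq_zero_of_mul_eq_mul hφ (n := unipotentElt (a * t) 0 0 0)
      (n' := unipotentElt (-b * t) 0 0 0)
      (GSp4.ext_entry_and ?_) (by simpa using ht.symm)
    simp [h]
    exact ⟨by ring, by linear_combination t * (c03 - c12)⟩

/-- Monomial matrices in the Klingen cell. -/
theorem eq_zero_of_klingen_monomial (hψ₁ : ψ₁ ≠ 1)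
    (hφ : φ ∈ heckeSpace (psiN ψ₁ ψ₂)) (hrel : ∀ x, φ (relevantElt x) = 0)
    {g : GSp4 F} {a b c d : F} (h : ∀ i j, gspEntry g i j =
      !![0, 0, 0, a; 0, b, 0, 0; 0, 0, c, 0; d, 0, 0, 0] i j) : φ g = 0 := by
  obtain ⟨m, hm, hcol, -⟩ := GSp4.exists_relations g
  have c12 := hcol 1 2
  have c03 := hcol 0 3
  simp [formJ, h] at c12 c03
  have hd : d ≠ 0 := by
    rintro rfl
    exact hm (by simpa using c03.symm)
  have hc : c ≠ 0 := by
    rintro rfl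
    exact hm (by simpa using c12.symm)
  -- Conjugation carries the `x`-coordinate `b * t` to `c * t`.
  by_cases hbc : c = b
  · have ha : a = -(c * c / d) := by
      subst hbc
      field_simp
      linear_combination -c03 + c12
    have e : g = relevantElt (.inr (.inr (.inl (Units.mk0 d hd, Units.mk0 c hc)))) := by
      refine GSp4.ext_entry_and ?_
      simp [relevantElt, klingenElt, gspEntry_mk, h, ha, ← hbc]
    rw [e]
    exact hrel _
  · obtain ⟨t, ht⟩ := AddChar.exists_mul_ne_mul hψ₁ hbc
    refine heckeSpace_eq_zero_of_mul_eq_mul hφ (n := unipotentElt 0 (b * t) 0 0)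
      (n' := unipotentElt 0 (c * t) 0 0)
      (GSp4.ext_entry_and ?_) (by simpa using ht.symm)
    simp [h]
    ring

/-- Monomial matrices in the big cell. -/
theorem eq_zero_of_bigCell_monomial (hrel : ∀ x, φ (relevantElt x) = 0)
    {g : GSp4 F} {a b c d : F} (h : ∀ i j, gspEntry g i j =
      !![0, 0, 0, a; 0, 0, b, 0; 0, c, 0, 0; d, 0, 0, 0] i j) : φ g = 0 := by
  obtain ⟨m, hm, hcol, -⟩ := GSp4.exists_relations g
  have c12 := hcol 1 2
  have c03 := hcol 0 3
  simp [formJ, h] at c12 c03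
  have hd : d ≠ 0 := by
    rintro rfl
    exact hm (by simpa using c03.symm)
  have hc : c ≠ 0 := by
    rintro rfl
    exact hm (by simpa using c12.symm)
  have hb : b ≠ 0 := by
    rintro rfl
    exact hm (by simpa using c12.symm)
  have ha : a = b * c / d := by
    field_simp
    linear_combination -c03 + c12
  have e : g = relevantElt (.inr (.inr (.inr
      (Units.mk0 b hb, Units.mk0 c hc, Units.mk0 d hd)))) := by
    refine GSp4.ext_entry_and ?_
    simp [relevantElt, bigCellElt, gspEntry_mk, h, ha]
  rw [e]
  exact hrel _

/-- Once the row and column of the pivot `(3, 1)` are cleared, entry `(2, 0)` decides. If it is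
zero, a `w`-element on the right matches an `x`-element on the left and `ψ₁` excludes the coset;
otherwise it serves as a second pivot and leads to a Siegel monomial matrix. -/
theorem eq_zero_of_row_three_pos_one_reduced (hψ₁ : ψ₁ ≠ 1) (hψ₂ : ψ₂ ≠ 1)
    (hφ : φ ∈ heckeSpace (psiN ψ₁ ψ₂)) (hrel : ∀ x, φ (relevantElt x) = 0)
    (g : GSp4 F) (h30 : gspEntry g 3 0 = 0) (h31 : gspEntry g 3 1 ≠ 0)
    (h32 : gspEntry g 3 2 = 0) (h33 : gspEntry g 3 3 = 0) (h01 : gspEntry g 0 1 = 0)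
    (h11 : gspEntry g 1 1 = 0) (h21 : gspEntry g 2 1 = 0) : φ g = 0 := by
  obtain ⟨c, hc, hcol, hrow⟩ := GSp4.exists_relations g
  have c10 := hcol 1 0
  have c13 := hcol 1 3
  have c12 := hcol 1 2
  have c03 := hcol 0 3
  have r1 := hrow 1 3
  have r2 := hrow 2 3
  simp [formJ, h30, h31, h32, h33, h01, h11, h21] at c10 c13 c12 c03 r1 r2
  by_cases h20 : gspEntry g 2 0 = 0
  · simp [h20] at c03
    have h10 : gspEntry g 1 0 ≠ 0 := by
      intro h
      rw [h, zero_mul] at c03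
      exact hc c03.symm
    obtain ⟨t, ht⟩ := AddChar.exists_mul_ne_one hψ₁ h10
    refine heckeSpace_eq_zero_of_mul_eq_mul hφ
      (n := unipotentElt 0 (gspEntry g 1 0 * t) 0 0)
      (n' := unipotentElt 0 0 0 (t * gspEntry g 2 3))
      (GSp4.ext_entry_and ?_) (by simpa using ht)
    simp [h30, h32, h33, h01, h11, h21, c10, c13, r1, r2, h20]
    ring
  let w := -(gspEntry g 2 3 / gspEntry g 2 0)
  let x := -(gspEntry g 1 0 / gspEntry g 2 0)
  refine heckeSpace_eq_zero_of_left hφ (unipotentElt 0 x 0 0) ?_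
  refine heckeSpace_eq_zero_of_right hφ (unipotentElt 0 0 0 w) ?_
  refine eq_zero_of_siegel_monomial (a := gspEntry g 0 2)
    (b := gspEntry g 1 3 - gspEntry g 1 0 / gspEntry g 2 0 * gspEntry g 2 3)
    (c := gspEntry g 2 0) (d := gspEntry g 3 1) hψ₂ hφ hrel ?_
  rw [Fin.forall_fin_four]
  simp only [Fin.forall_fin_four]
  simp [h30, h32, h33, h01, h11, h21, c10, c13, r1, r2, w, x]
  refine ⟨⟨?_, ?_⟩, ?_⟩ <;> field_simp <;> ring

theorem eq_zero_of_row_three_pos_one_row_reduced (hψ₁ : ψ₁ ≠ 1) (hψ₂ : ψ₂ ≠ 1)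
    (hφ : φ ∈ heckeSpace (psiN ψ₁ ψ₂)) (hrel : ∀ x, φ (relevantElt x) = 0)
    (g : GSp4 F) (h30 : gspEntry g 3 0 = 0) (h31 : gspEntry g 3 1 ≠ 0)
    (h32 : gspEntry g 3 2 = 0) (h33 : gspEntry g 3 3 = 0) : φ g = 0 := by
  let y := gspEntry g 2 1 / gspEntry g 3 1
  let z := -(gspEntry g 1 1 / gspEntry g 3 1)
  let w := -((gspEntry g 0 1 + y * gspEntry g 1 1 + z * gspEntry g 2 1) / gspEntry g 3 1)
  refine heckeSpace_eq_zero_of_left hφ (unipotentElt y 0 z w) ?_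
  refine eq_zero_of_row_three_pos_one_reduced hψ₁ hψ₂ hφ hrel _ ?_ ?_ ?_ ?_ ?_ ?_ ?_
  · simpa using h30
  · simpa using h31
  · simpa using h32
  · simpa using h33
  · simp [w]; field_simp; ring
  · simp [z]; field_simp; ring
  · simp [y]; field_simp; ring

theorem eq_zero_of_row_three_pos_one (hψ₁ : ψ₁ ≠ 1) (hψ₂ : ψ₂ ≠ 1)
    (hφ : φ ∈ heckeSpace (psiN ψ₁ ψ₂)) (hrel : ∀ x, φ (relevantElt x) = 0)
    (g : GSp4 F) (h30 : gspEntry g 3 0 = 0) (h31 : gspEntry g 3 1 ≠ 0) : φ g = 0 := by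
  refine heckeSpace_eq_zero_of_right hφ (unipotentElt 0 (-(gspEntry g 3 2 / gspEntry g 3 1))
    (-(gspEntry g 3 3 / gspEntry g 3 1)) 0) ?_
  refine eq_zero_of_row_three_pos_one_row_reduced hψ₁ hψ₂ hφ hrel _ ?_ ?_ ?_ ?_
  · simpa using h30
  · simpa using h31
  · simp [h30]; field_simp; ring
  · simp [h30]; field_simp; ring

/-- What remains is the Bruhat decomposition of the middle 2 × 2 block: entry `(2, 1)` zero leads to
the Klingen cell, nonzero to the big cell. -/
theorem eq_zero_of_row_three_pos_zero_reduced (hψ₁ : ψ₁ ≠ 1)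
    (hφ : φ ∈ heckeSpace (psiN ψ₁ ψ₂)) (hrel : ∀ x, φ (relevantElt x) = 0)
    (g : GSp4 F) (h30 : gspEntry g 3 0 ≠ 0) (h31 : gspEntry g 3 1 = 0)
    (h32 : gspEntry g 3 2 = 0) (h33 : gspEntry g 3 3 = 0) (h00 : gspEntry g 0 0 = 0)
    (h10 : gspEntry g 1 0 = 0) (h20 : gspEntry g 2 0 = 0) : φ g = 0 := by
  obtain ⟨c, hc, hcol, hrow⟩ := GSp4.exists_relations g
  have c01 := hcol 0 1
  have c02 := hcol 0 2
  have c12 := hcol 1 2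
  have r1 := hrow 1 3
  have r2 := hrow 2 3
  simp [formJ, h30, h31, h32, h33, h00, h10, h20] at c01 c02 c12 r1 r2
  by_cases h21 : gspEntry g 2 1 = 0
  · have h22 : gspEntry g 2 2 ≠ 0 := by
      intro h
      rw [h, h21, mul_zero, zero_mul, sub_zero] at c12
      exact hc c12.symm
    refine heckeSpace_eq_zero_of_left hφ
      (unipotentElt 0 (-(gspEntry g 1 2 / gspEntry g 2 2)) 0 0) ?_
    refine eq_zero_of_klingen_monomial (a := gspEntry g 0 3) (b := gspEntry g 1 1)
      (c := gspEntry g 2 2) (d := gspEntry g 3 0) hψ₁ hφ hrel ?_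
    rw [Fin.forall_fin_four]
    simp only [Fin.forall_fin_four]
    simp [h31, h32, h33, h00, h10, h20, c01, c02, r1, r2, h21]
    field_simp
    ring
  · refine heckeSpace_eq_zero_of_left hφ
      (unipotentElt 0 (-(gspEntry g 1 1 / gspEntry g 2 1)) 0 0) ?_
    refine heckeSpace_eq_zero_of_right hφ
      (unipotentElt 0 (-(gspEntry g 2 2 / gspEntry g 2 1)) 0 0) ?_
    refine eq_zero_of_bigCell_monomial (a := gspEntry g 0 3)
      (b := gspEntry g 1 2 - gspEntry g 1 1 / gspEntry g 2 1 * gspEntry g 2 2)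
      (c := gspEntry g 2 1) (d := gspEntry g 3 0) hrel ?_
    rw [Fin.forall_fin_four]
    simp only [Fin.forall_fin_four]
    simp [h31, h32, h33, h00, h10, h20, c01, c02, r1, r2]
    refine ⟨⟨?_, ?_⟩, ?_⟩ <;> field_simp <;> ring

theorem eq_zero_of_row_three_pos_zero_row_reduced (hψ₁ : ψ₁ ≠ 1)
    (hφ : φ ∈ heckeSpace (psiN ψ₁ ψ₂)) (hrel : ∀ x, φ (relevantElt x) = 0)
    (g : GSp4 F) (h30 : gspEntry g 3 0 ≠ 0) (h31 : gspEntry g 3 1 = 0)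
    (h32 : gspEntry g 3 2 = 0) (h33 : gspEntry g 3 3 = 0) : φ g = 0 := by
  let y := gspEntry g 2 0 / gspEntry g 3 0
  let z := -(gspEntry g 1 0 / gspEntry g 3 0)
  let w := -((gspEntry g 0 0 + y * gspEntry g 1 0 + z * gspEntry g 2 0) / gspEntry g 3 0)
  refine heckeSpace_eq_zero_of_left hφ (unipotentElt y 0 z w) ?_
  refine eq_zero_of_row_three_pos_zero_reduced hψ₁ hφ hrel _ ?_ ?_ ?_ ?_ ?_ ?_ ?_
  · simpa using h30
  · simpa using h31
  · simpa using h32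
  · simpa using h33
  · simp [w]; field_simp; ring
  · simp [z]; field_simp; ring
  · simp [y]; field_simp; ring

theorem eq_zero_of_row_three_pos_zero (hψ₁ : ψ₁ ≠ 1)
    (hφ : φ ∈ heckeSpace (psiN ψ₁ ψ₂)) (hrel : ∀ x, φ (relevantElt x) = 0)
    (g : GSp4 F) (h30 : gspEntry g 3 0 ≠ 0) : φ g = 0 := by
  let y := -(gspEntry g 3 1 / gspEntry g 3 0)
  let z := -(gspEntry g 3 2 / gspEntry g 3 0)
  let w := -((gspEntry g 3 1 * z - gspEntry g 3 2 * y + gspEntry g 3 3) / gspEntry g 3 0)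
  refine heckeSpace_eq_zero_of_right hφ (unipotentElt y 0 z w) ?_
  refine eq_zero_of_row_three_pos_zero_row_reduced hψ₁ hφ hrel _ ?_ ?_ ?_ ?_
  · simpa using h30
  · simp [y]; field_simp; ring
  · simp [z]; field_simp; ring
  · simp [w]; field_simp; ring

/-- A function transforming on both sides by `ψ_N` and vanishing at the representatives of the
relevant double cosets is zero. -/
theorem eq_zero_of_relevantElt (hψ₁ : ψ₁ ≠ 1) (hψ₂ : ψ₂ ≠ 1)
    (hφ : φ ∈ heckeSpace (psiN ψ₁ ψ₂)) (hrel : ∀ x, φ (relevantElt x) = 0)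
    (g : GSp4 F) : φ g = 0 := by
  -- The position of the first nonzero entry in the last row is unchanged by `N` on either side, so
  -- it separates the cases.
  by_cases h0 : gspEntry g 3 0 = 0
  · by_cases h1 : gspEntry g 3 1 = 0
    · by_cases h2 : gspEntry g 3 2 = 0
      · exact eq_zero_of_row_three_pos_three hψ₁ hψ₂ hφ hrel g h0 h1 h2
      · exact eq_zero_of_row_three_pos_two hψ₁ hφ g h0 h1 h2
    · exact eq_zero_of_row_three_pos_one hψ₁ hψ₂ hφ hrel g h0 h1
  · exact eq_zero_of_row_three_pos_zero hψ₁ hφ hrel g h0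

end

/-! ### Commutativity, the dimension count and the conclusion. -/

section

variable [Finite F] {ψ₁ ψ₂ : AddChar F ℂ}

theorem end_gelfandGraev_commute (hψ₁ : ψ₁ ≠ 1) (hψ₂ : ψ₂ ≠ 1)
    (S T : IntertwiningMap (gelfandGraev ψ₁ ψ₂) (gelfandGraev ψ₁ ψ₂)) : S * T = T * S :=
  end_indChar_commute (psiN ψ₁ ψ₂) antiInvolution_involutive.toPerm antiInvolution_mul
    (fun _ hφ => heckeSpace_apply_antiautomorphism relevantElt
      (fun _ => eq_zero_of_relevantElt hψ₁ hψ₂) antiInvolution antiInvolution_mul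
      antiInvolution_relevantElt (antiInvolution_mem_unipotentN ψ₁ ψ₂) hφ) S T

theorem finrank_end_gelfandGraev (hψ₁ : ψ₁ ≠ 1) (hψ₂ : ψ₂ ≠ 1) :
    Module.finrank ℂ (IntertwiningMap (gelfandGraev ψ₁ ψ₂) (gelfandGraev ψ₁ ψ₂)) =
      Nat.card F ^ 2 * (Nat.card F - 1) := by
  classical
  have : Fintype F := Fintype.ofFinite F
  have h := finrank_end_indChar (psiN ψ₁ ψ₂)
  rw [finrank_heckeSpace relevantElt (fun _ => eq_zero_of_relevantElt hψ₁ hψ₂)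
    (relevantElt_unique ψ₁ ψ₂)] at h
  refine h.trans ?_
  simp only [Fintype.card_sum, Fintype.card_prod, Fintype.card_units, Nat.card_eq_fintype_card]
  -- With q = k + 1 the truncated subtraction disappears and the count is k + 2k² + k³ = (k + 1)²k.
  obtain ⟨k, hk⟩ : ∃ k, Fintype.card F = k + 1 :=
    ⟨_, (Nat.succ_pred_eq_of_pos Fintype.card_pos).symm⟩
  rw [hk, Nat.add_sub_cancel]
  ring

end

end

theorem mainTheorem4 {F : Type*} [Field F] [Fintype F] (hodd : Odd (Fintype.card F))
    (ψ₁ ψ₂ : AddChar F ℂ) (hψ₁ : ψ₁ ≠ 1) (hψ₂ : ψ₂ ≠ 1) :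
    charInner (gelfandGraev ψ₁ ψ₂).character (gelfandGraev ψ₁ ψ₂).character =
        (Fintype.card F : ℂ) ^ 2 * ((Fintype.card F : ℂ) - 1) ∧
      (∀ (V : Type*) [AddCommGroup V] [Module ℂ V] [FiniteDimensional ℂ V]
        (π : Representation ℂ (GSp4 F) V), IsGeneric ψ₁ ψ₂ π →
          charInner π.character (gelfandGraev ψ₁ ψ₂).character = 1 ∧
          Module.finrank ℂ (Representation.IntertwiningMap π (gelfandGraev ψ₁ ψ₂)) = 1) ∧
      (genericClasses ψ₁ ψ₂).ncard = Fintype.card F ^ 2 * (Fintype.card F - 1) := by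
  have hcomm := end_gelfandGraev_commute hψ₁ hψ₂
  have hrank := finrank_end_gelfandGraev hψ₁ hψ₂
  rw [Nat.card_eq_fintype_card] at hrank
  refine ⟨?_, fun V _ _ _ π hπ => ?_, ?_⟩
  · rw [charInner_eq_finrank, hrank, Nat.cast_mul, Nat.cast_pow,
      Nat.cast_sub (Nat.one_le_iff_ne_zero.2 Fintype.card_ne_zero), Nat.cast_one]
  · obtain ⟨hirr, f, hf⟩ := hπ
    have h := IsIrreducible.finrank_eq_one_of_commute hcomm hf
    exact ⟨by rw [charInner_eq_finrank, h, Nat.cast_one], h⟩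
  · rw [← hrank]
    -- `genericClasses` unfolds to the constituent classes of `gelfandGraev`.
    exact ncard_constituentClasses hcomm
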